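/- Let $\mathcal X=\prod_{i=1}^n\mathcal X_i$ and $\mathcal Y=\prod_{j=1}^m\mathcal Y_j$ be finite products of Euclidean spaces, $A:\mathcal X\to\mathcal Y$ a linear operator with blocks $A_{j,i}:\mathcal X_i\to\mathcal Y_j$ (if all $\mathcal X_i=\mathcal Y_j=\mathbb R$, these are the entries of a matrix, and $\|A_{j,i}\|^2=A_{j,i}^2$). Consider $\min_{x\in\mathcal X} f(x)+g(x)+h(Ax)$ under the following assumptions. - $f:\mathcal X\to\mathbb R$ is convex and differentiable, and there are constants $\beta_i$ with $f(x+U_i(u))\le f(x)+\langle\nabla_i f(x),u\rangle+\frac{\beta_i}{2}\|u\|^2$ for all $x\in\mathcal X$, $i$, $u\in\mathcal X_i$, where $U_i(u)\in\mathcal X$ has block $i$ equal to $u$ and all other blocks $0$. - $g:\mathcal X\to\mathbb R\cup\{+\infty\}$ and $h:\mathcal Y\to\mathbb R\cup\{+\infty\}$ are proper, lower semicontinuous and convex, and $g$ is separable, $g(x)=\sum_{i=1}^n g_i(x_i)$ with $g_i:\mathcal X_i\to\mathbb R\cup\{+\infty\}$. - The set $\mathcal Z_\star$ of $(x_\star,y_\star)\in\mathcal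 X\times\mathcal Y$ with $0\in\nabla f(x_\star)+\partial g(x_\star)+A^\top y_\star$ and $0\in Ax_\star-\partial h^*(y_\star)$ is nonempty, where $h^*$ is the Fenchel conjugate of $h$. - Slater's condition holds: $0\in\mathrm{ri}(\mathrm{dom}\,h-A\,\mathrm{dom}\,g)$. Let $p_1,\dots,p_n>0$ with $\sum_i p_i=1$, $p_{\min}=\min_i p_i$, $I(j)=\{i: A_{j,i}\ne0\}$, $J(i)=\{j: A_{j,i}\neq 0\}$, $\pi_j=\sum_{i\in I(j)}p_i$ and $\theta_j=\pi_j/p_{\min}$, and assume $\theta_j>0$ for all $j$ (no block row of $A$ vanishes). Let the step sizes $\tau_1,\dots,\tau_n,\sigma_1,\dots,\sigma_m>0$ satisfy, for every $i$, $$\tau_i<\frac{2p_i-p_{\min}}{\beta_i p_i+p_{\min}^{-1}p_i\sum_{j=1}^m\pi_j\sigma_j\|A_{j,i}\|^2}$$ (no restriction if the denominator is $0$). For a positive vector $t$ with one entry per block, let $\mathrm{prox}_{t,\varphi}(x)=\arg\min_u \varphi(u)+\frac12\sum_i t_i^{-1}\|u_i-x_i\|^2$. Let $i_1,i_2,\dots$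 be independent random indices in $\{1,\dots,n\}$ with $\mathbb P(i_{k}=i)=p_i$, let $z_0=(x_0,y_0)\in\mathcal X\times\mathcal Y$ be arbitrary, and let $z_k=(x_k,y_k)$ be the PURE-CD iterates: for $k=0,1,\dots$, with $\sigma=\mathrm{diag}(\sigma_j)$, $\tau=\mathrm{diag}(\tau_i)$, $$\bar y_{k+1}=\mathrm{prox}_{\sigma,h^*}(y_k+\sigma Ax_k),\qquad \bar x_{k+1}=\mathrm{prox}_{\tau,g}\bigl(x_k-\tau(\nabla f(x_k)+A^\top\bar y_{k+1})\bigr),$$ $$x_{k+1}^{i_{k+1}}=\bar x_{k+1}^{i_{k+1}},\qquad x_{k+1}^{l}=x_k^{l}\ \ (l\ne i_{k+1}),$$ $$y_{k+1}^j=\bar y_{k+1}^j+\sigma_j\theta_j\bigl(A(x_{k+1}-x_k)\bigr)_j\ \ (j\in J(i_{k+1})),\qquad y_{k+1}^j=y_k^j\ \ (j\notin J(i_{k+1})).$$ Then, almost surely, there exists $z_\star=(x_\star,y_\star)\in\mathcal Z_\star$ such that $z_k\to z_\star$. -/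

import Mathlib

namespace PureCD

open scoped Pointwise

noncomputable section

/-- The Euclidean space `∏ i, ℝ^(d i)`, a product of `n` Euclidean blocks, with its Euclidean
(`ℓ²`) norm and inner product. -/
abbrev Blocks {n : ℕ} (d : Fin n → ℕ) : Type :=
  PiLp 2 fun i => EuclideanSpace ℝ (Fin (d i))

/-! ### Convex analysis -/

section Convex

variable {E : Type*} [NormedAddCommGroup E] [InnerProductSpace ℝ E]

/-- Proper, lower semicontinuous and convex functions with values in `ℝ ∪ {+∞}`;
convexity is convexity of the epigraph. -/
structure ProperLscConvex (φ : E → EReal) : Prop where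
  ne_bot : ∀ x, φ x ≠ ⊥
  exists_ne_top : ∃ x, φ x ≠ ⊤
  lsc : LowerSemicontinuous φ
  convex : Convex ℝ {q : E × ℝ | φ q.1 ≤ (q.2 : EReal)}

/-- The effective domain. -/
def effDom (φ : E → EReal) : Set E := {x | φ x ≠ ⊤}

/-- The Fenchel conjugate `φ*(y) = sup_v ⟨v, y⟩ - φ(v)`. -/
def conj (φ : E → EReal) (y : E) : EReal :=
  ⨆ v : E, ((inner ℝ v y : ℝ) : EReal) - φ v

/-- The convex subdifferential. -/
def subdiff (φ : E → EReal) (x : E) : Set E :=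
  {v | ∀ w, φ x + ((inner ℝ v (w - x) : ℝ) : EReal) ≤ φ w}

end Convex

section BlockNotions

variable {n m : ℕ} {d : Fin n → ℕ} {e : Fin m → ℕ}

/-- `u` minimizes `φ(u) + ½ ‖u - x‖²_{t⁻¹}`, for the diagonal metric `t` that is constant on
each block. -/
def IsProx (t : Fin n → ℝ) (φ : Blocks d → EReal) (x u : Blocks d) : Prop :=
  ∀ w : Blocks d,
    φ u + ((1 / 2 * ∑ i, (t i)⁻¹ * ‖u i - x i‖ ^ 2 : ℝ) : EReal) ≤
      φ w + ((1 / 2 * ∑ i, (t i)⁻¹ * ‖w i - x i‖ ^ 2 : ℝ) : EReal)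

/-- The proximal operator `argmin_u φ(u) + ½ ‖u - x‖²_{t⁻¹}`. -/
def prox (t : Fin n → ℝ) (φ : Blocks d → EReal) (x : Blocks d) : Blocks d :=
  Classical.epsilon fun u => IsProx t φ x u

/-- `g(x) = ∑ i, g_i(x_i)` with functions `g_i` with values in `ℝ ∪ {+∞}`. -/
def IsSeparable (g : Blocks d → EReal) : Prop :=
  ∃ gi : ∀ i, EuclideanSpace ℝ (Fin (d i)) → EReal,
    (∀ i u, gi i u ≠ ⊥) ∧ ∀ x, g x = ∑ i, gi i (x i)

/-- Coordinatewise smoothness with constants `β i`: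
`f(x + U_i u) ≤ f(x) + ⟨∇_i f(x), u⟩ + (β i / 2) ‖u‖²`. -/
def CoordSmooth (f : Blocks d → ℝ) (β : Fin n → ℝ) : Prop :=
  Differentiable ℝ f ∧
    ∀ (x : Blocks d) (i : Fin n) (u : EuclideanSpace ℝ (Fin (d i))),
      f (x + PiLp.single 2 i u) ≤
        f x + inner ℝ ((gradient f x) i) u + β i / 2 * ‖u‖ ^ 2

/-- The block `A_{j,i}` of a linear operator between products of Euclidean spaces. -/
def block (A : Blocks d →L[ℝ] Blocks e) (j : Fin m) (i : Fin n) :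
    EuclideanSpace ℝ (Fin (d i)) →L[ℝ] EuclideanSpace ℝ (Fin (e j)) :=
  LinearMap.toContinuousLinearMap
    { toFun := fun u => (A (PiLp.single 2 i u)) j
      map_add' := fun u v => by simp [PiLp.single_add]
      map_smul' := fun c u => by
        have hs : (PiLp.single 2 i (c • u) : Blocks d) = c • PiLp.single 2 i u := by
          rw [← PiLp.toLp_single, ← PiLp.toLp_single, Pi.single_smul, WithLp.toLp_smul]
        simp [hs] }

/-- `p_min = min_i p_i`. -/
def minProb (p : Fin n → ℝ) : ℝ := ⨅ i, p i

open Classical in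
/-- `π_j = ∑_{i ∈ I(j)} p_i`, where `I(j) = {i : A_{j,i} ≠ 0}`. -/
def rowProb (A : Blocks d →L[ℝ] Blocks e) (p : Fin n → ℝ) (j : Fin m) : ℝ :=
  ∑ i with block A j i ≠ 0, p i

/-- The primal-dual solutions: `0 ∈ ∇f(x) + ∂g(x) + Aᵀ y` and `0 ∈ A x - ∂h*(y)`. -/
def kktSet (f : Blocks d → ℝ) (g : Blocks d → EReal) (h : Blocks e → EReal)
    (A : Blocks d →L[ℝ] Blocks e) : Set (Blocks d × Blocks e) :=
  {z | (∃ v ∈ subdiff g z.1, gradient f z.1 + v + A.adjoint z.2 = 0) ∧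
       (∃ w ∈ subdiff (conj h) z.2, A z.1 - w = 0)}

/-! ### The algorithm -/

/-- `ȳ_{k+1} = prox_{σ, h*}(y_k + σ A x_k)`. -/
def yBar (h : Blocks e → EReal) (A : Blocks d →L[ℝ] Blocks e) (σ : Fin m → ℝ)
    (z : Blocks d × Blocks e) : Blocks e :=
  prox σ (conj h) (WithLp.toLp 2 fun j => z.2 j + σ j • (A z.1) j)

/-- `x̄_{k+1} = prox_{τ, g}(x_k - τ (∇f(x_k) + Aᵀ ȳ_{k+1}))`. -/
def xBar (f : Blocks d → ℝ) (g : Blocks d → EReal) (h : Blocks e → EReal)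
    (A : Blocks d →L[ℝ] Blocks e) (τ : Fin n → ℝ) (σ : Fin m → ℝ)
    (z : Blocks d × Blocks e) : Blocks d :=
  prox τ g (WithLp.toLp 2 fun i =>
    z.1 i - τ i • (gradient f z.1 + A.adjoint (yBar h A σ z)) i)

/-- `x_{k+1}` when block `i` is drawn: only block `i` is replaced by that of `x̄_{k+1}`. -/
def xNext (f : Blocks d → ℝ) (g : Blocks d → EReal) (h : Blocks e → EReal)
    (A : Blocks d →L[ℝ] Blocks e) (τ : Fin n → ℝ) (σ : Fin m → ℝ)
    (i : Fin n) (z : Blocks d × Blocks e) : Blocks d :=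
  WithLp.toLp 2 fun l => if l = i then xBar f g h A τ σ z l else z.1 l

open Classical in
/-- `y_{k+1}` when block `i` is drawn: the blocks `j ∈ J(i) = {j : A_{j,i} ≠ 0}` become
`ȳ_{k+1}^j + σ_j θ_j (A (x_{k+1} - x_k))_j`, the others are kept. -/
def yNext (f : Blocks d → ℝ) (g : Blocks d → EReal) (h : Blocks e → EReal)
    (A : Blocks d →L[ℝ] Blocks e) (τ : Fin n → ℝ) (σ θ : Fin m → ℝ)
    (i : Fin n) (z : Blocks d × Blocks e) : Blocks e :=
  WithLp.toLp 2 fun j =>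
    if block A j i ≠ 0 then
      yBar h A σ z j + (σ j * θ j) • (A (xNext f g h A τ σ i z - z.1)) j
    else z.2 j

/-- The PURE-CD iterates `z_k = (x_k, y_k)` from `z0`, along the sequence of drawn indices,
`idx k` being the index drawn in iteration `k` (it is used to pass from `z_k` to `z_{k+1}`). -/
def iterate (f : Blocks d → ℝ) (g : Blocks d → EReal) (h : Blocks e → EReal)
    (A : Blocks d →L[ℝ] Blocks e) (τ : Fin n → ℝ) (σ θ : Fin m → ℝ)
    (z0 : Blocks d × Blocks e) (idx : ℕ → Fin n) : ℕ → Blocks d × Blocks e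
  | 0 => z0
  | k + 1 =>
      let z := iterate f g h A τ σ θ z0 idx k
      (xNext f g h A τ σ (idx k) z, yNext f g h A τ σ θ (idx k) z)

end BlockNotions

end

end PureCD

open PureCD MeasureTheory ProbabilityTheory Filter Topology Pointwise

/-!
Let `a = minProb p` and `π j = rowProb A p j`. For a primal-dual solution `zs = (xs, ys)` consider
the Lyapunov function
`V(z) = a/2 ∑ i, ‖x i - xs i‖² / (τ i p i) + a/2 ∑ j, ‖y j - ys j‖² / (σ j π j) + Φ(x)`, where
`Φ(x) = f(x) + g(x) + ⟨A x, ys⟩ - (f(xs) + g(xs) + ⟨A xs, ys⟩) ≥ 0` is the primal gap.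
In one iteration started in the domain of `g`,
`𝔼 V(z⁺) ≤ V(z) - a Φ(x) - a/2 ‖ȳ - y‖²_{σ⁻¹} - ∑ i, κ i ‖x̄ i - x i‖²`
(`Setting.sum_lyapunov_le`), where `κ i > 0` is the step size condition. To see this, test the
optimality condition of block `i` of the proximal step for `x̄` against `xs i` with weight `a` and
against the current `x i` with weight `p i - a` (`Setting.primal_inequality`), test that of `ȳ`
against `ys` (`Setting.dual_inequality`), and add the descent inequality of `f`; the choice
`θ = π / a` makes the remaining cross terms cancel.

The Robbins–Siegmund lemma (`ae_tendsto_and_summable`), a consequence of Doob's convergence theorem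
for supermartingales, gives almost surely: `V(z_k)` converges, `Φ(x_k) → 0`, `x̄ - x_k → 0` and
`ȳ - y_k → 0`. So the distance to `zs` converges, for all `zs` in a countable dense set of solutions
at once; by closedness of the graphs of the subdifferentials and continuity of `∇f` every cluster
point is a solution (`Setting.mem_kktSet_of_tendsto`), and Opial's argument concludes
(`Setting.exists_tendsto`).

The starting point may lie outside the domain of `g`, where `Φ` is infinite. Each block of `x_k`
enters its domain when it is drawn, and almost surely every block is drawn; since the state
reached by then is one of countably many, the previous argument can be restarted there
(`ae_chain_of_restart`). Existence of the proximal points comes from an affine minorant, by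
Hahn–Banach (`ProperLscConvex.exists_affine_le`).
-/

/-! ### Convex functions with values in `ℝ ∪ {+∞}` -/

namespace PureCD

section Convex

variable {E : Type*} [NormedAddCommGroup E] [InnerProductSpace ℝ E] {φ : E → EReal}

theorem ProperLscConvex.coe_toReal (hφ : ProperLscConvex φ) {x : E} (hx : φ x ≠ ⊤) :
    ((φ x).toReal : EReal) = φ x :=
  EReal.coe_toReal hx (hφ.ne_bot x)

theorem ProperLscConvex.isClosed_epigraph (hφ : ProperLscConvex φ) :
    IsClosed {q : E × ℝ | φ q.1 ≤ (q.2 : EReal)} :=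
  hφ.lsc.isClosed_epigraph.preimage
    (continuous_fst.prodMk (continuous_coe_real_ereal.comp continuous_snd))

/-- A proper, lower semicontinuous and convex function has an affine minorant: separate its
epigraph from a point just below the graph. -/
theorem ProperLscConvex.exists_affine_le [CompleteSpace E] (hφ : ProperLscConvex φ) :
    ∃ (a : E) (b : ℝ), ∀ x, ((inner ℝ a x + b : ℝ) : EReal) ≤ φ x := by
  obtain ⟨x₀, hx₀⟩ := hφ.exists_ne_top
  set r := (φ x₀).toReal with hr
  have hr' : (r : EReal) = φ x₀ := hφ.coe_toReal hx₀
  have hnot : (x₀, r - 1) ∉ {q : E × ℝ | φ q.1 ≤ (q.2 : EReal)} := by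
    simp only [Set.mem_ofPred_eq, ← hr', EReal.coe_le_coe_iff]
    linarith
  obtain ⟨ℓ, s, hs, hs'⟩ := geometric_hahn_banach_point_closed hφ.convex hφ.isClosed_epigraph hnot
  have hℓ : ∀ x t, ℓ (x, t) = ℓ (x, 0) + t * ℓ (0, 1) := by
    intro x t
    rw [← smul_eq_mul, ← map_smul, ← map_add]
    simp
  have h0 := hs' (x₀, r) (by simp [← hr'])
  rw [hℓ] at h0 hs
  have hc : 0 < ℓ (0, 1) := by linarith
  set c := ℓ (0, 1)
  let a : E := (InnerProductSpace.toDual ℝ E).symm (ℓ.comp (ContinuousLinearMap.inl ℝ E ℝ))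
  have ha : ∀ x, inner ℝ a x = ℓ (x, 0) := fun x => by simp [a]
  refine ⟨-(c⁻¹ • a), c⁻¹ * s, fun x => ?_⟩
  by_cases hx : φ x = ⊤
  · simp [hx]
  rw [← hφ.coe_toReal hx, EReal.coe_le_coe_iff]
  have h1 := hs' (x, (φ x).toReal) (by simp [hφ.coe_toReal hx])
  rw [hℓ] at h1
  rw [inner_neg_left, real_inner_smul_left, ha]
  have h2 : c⁻¹ * (s - ℓ (x, 0)) ≤ (φ x).toReal := by
    rw [inv_mul_le_iff₀ hc]; linarith
  linarith

theorem le_conj (φ : E → EReal) (v y : E) : ((inner ℝ v y : ℝ) : EReal) - φ v ≤ conj φ y :=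
  le_iSup (fun v : E => ((inner ℝ v y : ℝ) : EReal) - φ v) v

/-- The Fenchel conjugate of a proper, lower semicontinuous and convex function is again such a
function. -/
theorem ProperLscConvex.conj [CompleteSpace E] (hφ : ProperLscConvex φ) :
    ProperLscConvex (conj φ) := by
  obtain ⟨x₀, hx₀⟩ := hφ.exists_ne_top
  have key : ∀ (y : E) (t : ℝ), PureCD.conj φ y ≤ t ↔
      ∀ v, φ v ≠ ⊤ → inner ℝ v y - (φ v).toReal ≤ t := by
    intro y t
    rw [PureCD.conj, iSup_le_iff]
    refine forall_congr' fun v => ?_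
    by_cases hv : φ v = ⊤
    · simp [hv]
    · rw [← hφ.coe_toReal hv, ← EReal.coe_sub, EReal.coe_le_coe_iff]
      simp
  refine ⟨fun y hy => ?_, ?_, ?_, ?_⟩
  · have := le_conj φ x₀ y
    rw [hy, ← hφ.coe_toReal hx₀, ← EReal.coe_sub] at this
    exact EReal.coe_ne_bot _ (le_bot_iff.1 this)
  · obtain ⟨a, b, hab⟩ := hφ.exists_affine_le
    refine ⟨a, fun h => ?_⟩
    have : PureCD.conj φ a ≤ ((-b : ℝ) : EReal) := by
      rw [key]
      intro v hv
      have := hab v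
      rw [← hφ.coe_toReal hv, EReal.coe_le_coe_iff, real_inner_comm] at this
      linarith
    rw [h] at this
    exact EReal.coe_ne_top _ (top_le_iff.1 this)
  · refine lowerSemicontinuous_iSup fun v => ?_
    by_cases hv : φ v = ⊤
    · simpa [hv] using lowerSemicontinuous_const
    · rw [← hφ.coe_toReal hv]
      simp_rw [← EReal.coe_sub]
      exact (continuous_coe_real_ereal.comp (by fun_prop)).lowerSemicontinuous
  · intro q hq q' hq' s t hs ht hst
    simp only [Set.mem_ofPred_eq, key] at hq hq' ⊢
    intro v hv
    have h1 := mul_le_mul_of_nonneg_left (hq v hv) hs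
    have h2 := mul_le_mul_of_nonneg_left (hq' v hv) ht
    simp only [Prod.fst_add, Prod.smul_fst, Prod.snd_add, Prod.smul_snd, smul_eq_mul,
      inner_add_right, real_inner_smul_right]
    have h3 : (φ v).toReal = s * (φ v).toReal + t * (φ v).toReal := by
      rw [← add_mul, hst, one_mul]
    linarith

theorem ProperLscConvex.ne_top_of_mem_subdiff (hφ : ProperLscConvex φ) {u v : E}
    (hv : v ∈ subdiff φ u) : φ u ≠ ⊤ := by
  intro hu
  obtain ⟨x₀, hx₀⟩ := hφ.exists_ne_top
  have := hv x₀
  rw [hu, EReal.top_add_coe] at this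
  exact hx₀ (top_le_iff.1 this)

theorem ProperLscConvex.mem_subdiff_iff (hφ : ProperLscConvex φ) {u v : E} :
    v ∈ subdiff φ u ↔ φ u ≠ ⊤ ∧
      ∀ w, φ w ≠ ⊤ → (φ u).toReal + inner ℝ v (w - u) ≤ (φ w).toReal := by
  constructor
  · intro hv
    have hu := hφ.ne_top_of_mem_subdiff hv
    refine ⟨hu, fun w hw => ?_⟩
    have := hv w
    rwa [← hφ.coe_toReal hu, ← hφ.coe_toReal hw, ← EReal.coe_add, EReal.coe_le_coe_iff] at this
  · rintro ⟨hu, h⟩ w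
    by_cases hw : φ w = ⊤
    · simp [hw]
    · rw [← hφ.coe_toReal hu, ← hφ.coe_toReal hw, ← EReal.coe_add, EReal.coe_le_coe_iff]
      exact h w hw

/-- The graph of the subdifferential is closed. -/
theorem ProperLscConvex.mem_subdiff_of_tendsto (hφ : ProperLscConvex φ) {u v : ℕ → E} {a b : E}
    (hu : Tendsto u atTop (𝓝 a)) (hv : Tendsto v atTop (𝓝 b))
    (huv : ∀ k, v k ∈ subdiff φ (u k)) : b ∈ subdiff φ a := by
  have key : ∀ w, φ w ≠ ⊤ → φ a ≤ (((φ w).toReal - inner ℝ b (w - a) : ℝ) : EReal) := by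
    intro w hw
    have hlim : Tendsto (fun k => (u k, (φ w).toReal - inner ℝ (v k) (w - u k))) atTop
        (𝓝 (a, (φ w).toReal - inner ℝ b (w - a))) :=
      hu.prodMk_nhds (tendsto_const_nhds.sub (hv.inner (tendsto_const_nhds.sub hu)))
    refine hφ.isClosed_epigraph.mem_of_tendsto hlim (Eventually.of_forall fun k => ?_)
    obtain ⟨h1, h2⟩ := hφ.mem_subdiff_iff.1 (huv k)
    have := h2 w hw
    rw [Set.mem_ofPred_eq, ← hφ.coe_toReal h1, EReal.coe_le_coe_iff]
    linarith
  obtain ⟨x₀, hx₀⟩ := hφ.exists_ne_top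
  have ha : φ a ≠ ⊤ := fun h => EReal.coe_ne_top _ (top_le_iff.1 (h ▸ key x₀ hx₀))
  refine hφ.mem_subdiff_iff.2 ⟨ha, fun w hw => ?_⟩
  have := key w hw
  rw [← hφ.coe_toReal ha, EReal.coe_le_coe_iff] at this
  linarith

/-- Convexity of the epigraph, read off on a segment. -/
theorem ProperLscConvex.convex_combo_le (hφ : ProperLscConvex φ) {u w : E} (hu : φ u ≠ ⊤)
    (hw : φ w ≠ ⊤) {t : ℝ} (ht0 : 0 ≤ t) (ht1 : t ≤ 1) :
    φ (u + t • (w - u)) ≤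
      (((φ u).toReal + t * ((φ w).toReal - (φ u).toReal) : ℝ) : EReal) := by
  have := hφ.convex (x := (u, (φ u).toReal)) (by simp [hφ.coe_toReal hu])
    (y := (w, (φ w).toReal)) (by simp [hφ.coe_toReal hw]) (sub_nonneg.2 ht1) ht0 (by ring)
  simp only [Set.mem_ofPred_eq, Prod.fst_add, Prod.smul_fst, Prod.snd_add, Prod.smul_snd,
    smul_eq_mul] at this
  convert this using 2
  · module
  · ring

/-- Adding a continuous function with quadratic growth to a proper, lower semicontinuous and
convex function, one obtains a function that attains its minimum. -/
theorem ProperLscConvex.exists_minimizer [FiniteDimensional ℝ E] (hφ : ProperLscConvex φ)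
    {q : E → ℝ} (hq : Continuous q) {x : E} {c : ℝ} (hc : 0 < c)
    (hgrow : ∀ u, c * ‖u - x‖ ^ 2 ≤ q u) :
    ∃ u, ∀ w, φ u + (q u : EReal) ≤ φ w + (q w : EReal) := by
  have : CompleteSpace E := FiniteDimensional.complete ℝ E
  have : ProperSpace E := FiniteDimensional.proper ℝ E
  obtain ⟨a, b, hab⟩ := hφ.exists_affine_le
  obtain ⟨x₀, hx₀⟩ := hφ.exists_ne_top
  set M := (φ x₀).toReal + q x₀ - inner ℝ a x - b with hM
  set R := 1 + ‖x₀ - x‖ + (‖a‖ + |M| + 1) / c with hR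
  have hRc : 0 ≤ (‖a‖ + |M| + 1) / c := by positivity
  have hlsc : LowerSemicontinuous fun u => φ u + (q u : EReal) :=
    hφ.lsc.add' (continuous_coe_real_ereal.comp hq).lowerSemicontinuous fun u =>
      EReal.continuousAt_add (Or.inr (EReal.coe_ne_bot _)) (Or.inr (EReal.coe_ne_top _))
  have hx₀R : x₀ ∈ Metric.closedBall x R := by
    rw [mem_closedBall_iff_norm]; linarith
  obtain ⟨u, -, hmin⟩ := LowerSemicontinuousOn.exists_isMinOn ⟨x₀, hx₀R⟩
    (isCompact_closedBall x R) (hlsc.lowerSemicontinuousOn _)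
  refine ⟨u, fun w => ?_⟩
  by_cases hw : w ∈ Metric.closedBall x R
  · exact hmin hw
  refine (hmin hx₀R).trans ?_
  by_cases hwt : φ w = ⊤
  · simp [hwt]
  have h1 := hab w
  simp only
  rw [← hφ.coe_toReal hwt, EReal.coe_le_coe_iff] at h1
  rw [← hφ.coe_toReal hwt, ← hφ.coe_toReal hx₀, ← EReal.coe_add, ← EReal.coe_add,
    EReal.coe_le_coe_iff]
  rw [mem_closedBall_iff_norm, not_le] at hw
  have h2 := hgrow w
  have h3 : inner ℝ a w = inner ℝ a x + inner ℝ a (w - x) := by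
    rw [← inner_add_right]; congr 1; abel
  have h4 : -(‖a‖ * ‖w - x‖) ≤ inner ℝ a (w - x) :=
    neg_le_of_abs_le (abs_real_inner_le_norm a (w - x))
  have h5 : ‖a‖ + |M| + 1 ≤ c * ‖w - x‖ := by
    rw [← div_le_iff₀' hc]
    linarith [norm_nonneg (x₀ - x)]
  have h6 : 1 ≤ ‖w - x‖ := by linarith [norm_nonneg (x₀ - x)]
  have h7 : |M| + 1 ≤ ‖w - x‖ * (c * ‖w - x‖ - ‖a‖) := by
    nlinarith [abs_nonneg M]
  have h8 := le_abs_self M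
  nlinarith

/-- A convex differentiable function lies above its tangents. -/
theorem add_inner_gradient_le [CompleteSpace E] {f : E → ℝ} (hf : ConvexOn ℝ Set.univ f)
    (hd : Differentiable ℝ f) (x w : E) : f x + inner ℝ (gradient f x) (w - x) ≤ f w := by
  rw [inner_gradient_left]
  have hline : HasDerivAt (fun t : ℝ => f (x + t • (w - x))) (fderiv ℝ f x (w - x)) 0 := by
    have h1 : HasDerivAt (fun t : ℝ => x + t • (w - x)) (w - x) 0 := by
      simpa using ((hasDerivAt_id (0 : ℝ)).smul_const (w - x)).const_add x
    have h2 : HasFDerivAt f (fderiv ℝ f x) (x + (0 : ℝ) • (w - x)) := by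
      simpa using (hd x).hasFDerivAt
    exact h2.comp_hasDerivAt 0 h1
  have hconv : ConvexOn ℝ Set.univ (fun t : ℝ => f (x + t • (w - x))) := by
    have h := hf.comp_affineMap (AffineMap.lineMap x w)
    rw [Set.preimage_univ] at h
    have hfun : (fun t : ℝ => f (x + t • (w - x))) = f ∘ AffineMap.lineMap (k := ℝ) x w := by
      funext t
      simp [AffineMap.lineMap_apply, add_comm]
    rwa [hfun]
  have := hconv.le_slope_of_hasDerivAt (Set.mem_univ 0) (Set.mem_univ 1) one_pos hline
  simp [slope_def_field] at this
  rw [map_sub]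
  linarith

/-- The gradient of a convex differentiable function on a finite-dimensional space is
continuous: its components are squeezed between difference quotients. -/
theorem continuous_gradient [FiniteDimensional ℝ E] [CompleteSpace E] {f : E → ℝ}
    (hf : ConvexOn ℝ Set.univ f) (hd : Differentiable ℝ f) : Continuous (gradient f) := by
  have upper : ∀ (x v : E) (ε : ℝ), 0 < ε →
      ∀ᶠ y in 𝓝 x, inner ℝ (gradient f y) v < inner ℝ (gradient f x) v + ε := by
    intro x v ε hε
    have hline : HasDerivAt (fun t : ℝ => f (x + t • v)) (inner ℝ (gradient f x) v) 0 := by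
      rw [inner_gradient_left]
      have h1 : HasDerivAt (fun t : ℝ => x + t • v) v 0 := by
        simpa using ((hasDerivAt_id (0 : ℝ)).smul_const v).const_add x
      have h2 : HasFDerivAt f (fderiv ℝ f x) (x + (0 : ℝ) • v) := by
        simpa using (hd x).hasFDerivAt
      exact h2.comp_hasDerivAt 0 h1
    have hslope := hline.tendsto_slope_zero_right
    obtain ⟨t, ht, ht0⟩ := ((hslope.eventually (gt_mem_nhds (lt_add_of_pos_right _ hε))).and
      self_mem_nhdsWithin).exists
    have ht0' : 0 < t := ht0
    simp only [zero_add, zero_smul, add_zero, smul_eq_mul] at ht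
    have hcont : Continuous fun y => t⁻¹ * (f (y + t • v) - f y) := by
      have := hd.continuous
      fun_prop
    filter_upwards [hcont.continuousAt.eventually (gt_mem_nhds ht)] with y hy
    refine lt_of_le_of_lt ?_ hy
    have := add_inner_gradient_le hf hd y (y + t • v)
    rw [add_sub_cancel_left, real_inner_smul_right] at this
    rw [le_inv_mul_iff₀ ht0']
    linarith
  have hinner : ∀ v, Continuous fun x => inner ℝ (gradient f x) v := by
    intro v
    refine continuous_iff_continuousAt.2 fun x => ?_
    rw [ContinuousAt, Metric.tendsto_nhds]
    intro ε hε
    filter_upwards [upper x v ε hε, upper x (-v) ε hε] with y h1 h2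
    rw [inner_neg_right, inner_neg_right] at h2
    rw [Real.dist_eq, abs_lt]
    constructor <;> linarith
  let b := stdOrthonormalBasis ℝ E
  have : gradient f = fun x => ∑ i, inner ℝ (gradient f x) (b i) • b i := by
    funext x
    conv_lhs => rw [← b.sum_repr' (gradient f x)]
    simp only [real_inner_comm]
  rw [this]
  exact continuous_finsetSum _ fun i _ => (hinner _).smul continuous_const

end Convex

/-! ### The proximal operator -/

theorem exists_pos_forall_le {n : ℕ} (s : Fin n → ℝ) (hs : ∀ i, 0 < s i) :
    ∃ c, 0 < c ∧ ∀ i, c ≤ s i := by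
  rcases isEmpty_or_nonempty (Fin n) with h | h
  · exact ⟨1, one_pos, fun i => h.elim i⟩
  · obtain ⟨i, hi⟩ := Finite.exists_min s
    exact ⟨s i, hs i, hi⟩

section Prox

variable {n : ℕ} {d : Fin n → ℕ} {t : Fin n → ℝ} {φ : Blocks d → EReal}

theorem norm_sq_blocks (x : Blocks d) : ‖x‖ ^ 2 = ∑ i, ‖x i‖ ^ 2 :=
  PiLp.norm_sq_eq_of_L2 _ x

/-- The minimum in the definition of `prox` is attained, so `prox` is not a junk value. -/
theorem isProx_prox (ht : ∀ i, 0 < t i) (hφ : ProperLscConvex φ) (x : Blocks d) :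
    IsProx t φ x (prox t φ x) := by
  refine Classical.epsilon_spec (p := fun u => IsProx t φ x u) ?_
  obtain ⟨c, hc, hct⟩ := exists_pos_forall_le (fun i => (t i)⁻¹) fun i => inv_pos.2 (ht i)
  refine hφ.exists_minimizer (x := x) (c := c / 2) (by fun_prop) (by positivity) fun u => ?_
  rw [norm_sq_blocks, Finset.mul_sum, Finset.mul_sum]
  refine Finset.sum_le_sum fun i _ => ?_
  rw [PiLp.sub_apply]
  have := mul_le_mul_of_nonneg_right (hct i) (sq_nonneg ‖u i - x i‖)
  linarith

/-- Optimality condition of the proximal problem. -/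
theorem IsProx.mem_subdiff (hφ : ProperLscConvex φ) {x u : Blocks d} (hu : IsProx t φ x u) :
    (WithLp.toLp 2 fun i => (t i)⁻¹ • (x i - u i) : Blocks d) ∈ subdiff φ u := by
  have hut : φ u ≠ ⊤ := by
    intro h
    obtain ⟨x₀, hx₀⟩ := hφ.exists_ne_top
    have := hu x₀
    rw [h, EReal.top_add_coe, ← hφ.coe_toReal hx₀, ← EReal.coe_add] at this
    exact EReal.coe_ne_top _ (top_le_iff.1 this)
  refine hφ.mem_subdiff_iff.2 ⟨hut, fun w hw => ?_⟩
  set S := ∑ i, (t i)⁻¹ * inner ℝ (x i - u i) (w i - u i) with hS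
  set Q := ∑ i, (t i)⁻¹ * ‖w i - u i‖ ^ 2 with hQ
  have hinner : inner ℝ (WithLp.toLp 2 fun i => (t i)⁻¹ • (x i - u i) : Blocks d) (w - u) = S := by
    rw [PiLp.inner_apply]
    simp [hS, real_inner_smul_left]
  rw [hinner]
  -- compare `u` with the points `u + s (w - u)` for small `s`
  have hsq : ∀ s : ℝ, 1 / 2 * ∑ i, (t i)⁻¹ * ‖(u + s • (w - u)) i - x i‖ ^ 2 =
      1 / 2 * ∑ i, (t i)⁻¹ * ‖u i - x i‖ ^ 2 - s * S + s ^ 2 / 2 * Q := by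
    intro s
    simp only [hS, hQ, Finset.mul_sum, ← Finset.sum_sub_distrib, ← Finset.sum_add_distrib]
    refine Finset.sum_congr rfl fun i _ => ?_
    have : (u + s • (w - u)) i - x i = (u i - x i) + s • (w i - u i) := by
      simp only [PiLp.add_apply, PiLp.smul_apply, PiLp.sub_apply]; abel
    rw [this, norm_add_sq_real, norm_smul, mul_pow, Real.norm_eq_abs, sq_abs,
      real_inner_smul_right, ← neg_sub (x i) (u i), inner_neg_left, norm_neg]
    ring
  have key : ∀ s : ℝ, 0 < s → s ≤ 1 →
      (φ u).toReal + S ≤ (φ w).toReal + s / 2 * Q := by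
    intro s hs0 hs1
    have h1 := hφ.convex_combo_le hut hw hs0.le hs1
    have h2 := hu (u + s • (w - u))
    rw [hsq] at h2
    have h3 := h2.trans (add_le_add_left h1 _)
    rw [← hφ.coe_toReal hut, ← EReal.coe_add, ← EReal.coe_add, EReal.coe_le_coe_iff] at h3
    simp only [EReal.toReal_coe] at h3
    have h4 : s * ((φ u).toReal + S) ≤ s * ((φ w).toReal + s / 2 * Q) := by
      linarith
    exact le_of_mul_le_mul_left h4 hs0
  have hlim : Tendsto (fun s : ℝ => (φ w).toReal + s / 2 * Q) (𝓝[>] 0)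
      (𝓝 ((φ w).toReal + 0 / 2 * Q)) :=
    (Continuous.tendsto (by fun_prop) 0).mono_left nhdsWithin_le_nhds
  rw [zero_div, zero_mul, add_zero] at hlim
  refine ge_of_tendsto hlim ?_
  filter_upwards [Ioc_mem_nhdsGT (zero_lt_one' ℝ)] with s hs
  exact key s hs.1 hs.2

end Prox

end PureCD

/-! ### Randomly driven sequences -/

namespace PureCD

section Chain

variable {n : ℕ} {α : Type*}

/-- The sequence obtained from `z0` by applying in iteration `k` the map `step (idx k)`. -/
def chain (step : Fin n → α → α) (z0 : α) (idx : ℕ → Fin n) : ℕ → α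
  | 0 => z0
  | k + 1 => step (idx k) (chain step z0 idx k)

variable {step : Fin n → α → α}

theorem chain_congr (z0 : α) {idx idx' : ℕ → Fin n} {k : ℕ} (h : ∀ l < k, idx l = idx' l) :
    chain step z0 idx k = chain step z0 idx' k := by
  induction k with
  | zero => rfl
  | succ k ih => simp only [chain, h k k.lt_succ_self, ih fun l hl => h l (hl.trans k.lt_succ_self)]

theorem chain_add (z0 : α) (idx : ℕ → Fin n) (N k : ℕ) :
    chain step z0 idx (N + k) = chain step (chain step z0 idx N) (fun l => idx (N + l)) k := by
  induction k with
  | zero => rfl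
  | succ k ih => rw [← add_assoc, chain, chain, ih]

theorem chain_mem {D : Set α} (hD : ∀ i, ∀ z ∈ D, step i z ∈ D) {z0 : α} (hz0 : z0 ∈ D)
    (idx : ℕ → Fin n) (k : ℕ) : chain step z0 idx k ∈ D := by
  induction k with
  | zero => exact hz0
  | succ k ih => exact hD _ _ ih

/-- A function of the state after `k` iterations depends on the first `k` drawn indices only, and
these take finitely many values: no measurability of `step` or `Y` is needed. -/
theorem exists_eq_comp_chain [NeZero n] {Ω : Type*} {ι : ℕ → Ω → Fin n} (z0 : α) (Y : α → ℝ) (k : ℕ) :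
    ∃ y : (Finset.range k → Fin n) → ℝ, (fun ω => Y (chain step z0 (fun l => ι l ω) k)) =
      y ∘ fun ω (l : Finset.range k) => ι l ω := by
  refine ⟨fun v => Y (chain step z0
    (fun l => if h : l ∈ Finset.range k then v ⟨l, h⟩ else 0) k), ?_⟩
  funext ω
  simp only [Function.comp_apply]
  congr 1
  refine chain_congr _ fun l hl => ?_
  rw [dif_pos (Finset.mem_range.2 hl)]

variable {Ω : Type*} [MeasurableSpace Ω] {μ : Measure Ω} {ι : ℕ → Ω → Fin n} {p : Fin n → ℝ}

/-- The `σ`-algebra generated by the indices drawn in the first `k` iterations. -/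
def drawnFiltration (ι : ℕ → Ω → Fin n) (hι : ∀ k, Measurable (ι k)) :
    Filtration ℕ (inferInstance : MeasurableSpace Ω) where
  seq k := MeasurableSpace.comap (fun ω (l : Finset.range k) => ι l ω) inferInstance
  mono' := by
    intro k l hkl
    rw [← measurable_iff_comap_le]
    have hle : ∀ i : Finset.range k, (i : ℕ) ∈ Finset.range l := fun i =>
      Finset.mem_range.2 ((Finset.mem_range.1 i.2).trans_le hkl)
    have hcomp : (fun ω (i : Finset.range k) => ι i ω) =
        (fun (v : Finset.range l → Fin n) (i : Finset.range k) => v ⟨i, hle i⟩) ∘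
          fun ω (i : Finset.range l) => ι i ω := rfl
    rw [hcomp]
    exact Measurable.of_discrete.comp (comap_measurable _)
  le' k := by
    rw [← measurable_iff_comap_le]
    exact measurable_pi_lambda _ fun i => hι i

theorem stronglyMeasurable_chain [NeZero n] (hι : ∀ k, Measurable (ι k)) (z0 : α) (Y : α → ℝ)
    (k : ℕ) : StronglyMeasurable[drawnFiltration ι hι k]
      fun ω => Y (chain step z0 (fun l => ι l ω) k) := by
  obtain ⟨y, hy⟩ := exists_eq_comp_chain (step := step) (ι := ι) z0 Y k
  rw [hy]
  exact (Measurable.of_discrete.comp (comap_measurable _)).stronglyMeasurable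

theorem integrable_chain [NeZero n] [IsFiniteMeasure μ] (hι : ∀ k, Measurable (ι k)) (z0 : α)
    (Y : α → ℝ) (k : ℕ) : Integrable (fun ω => Y (chain step z0 (fun l => ι l ω) k)) μ := by
  obtain ⟨y, hy⟩ := exists_eq_comp_chain (step := step) (ι := ι) z0 Y k
  obtain ⟨v, hv⟩ := Finite.exists_max fun v => ‖y v‖
  refine Integrable.of_bound (C := ‖y v‖) ((stronglyMeasurable_chain hι z0 Y k).mono
    ((drawnFiltration ι hι).le k)).aestronglyMeasurable (Eventually.of_forall fun ω => ?_)
  exact (congrArg norm (congrFun hy ω)).trans_le (hv _)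

/-- Given the past, the next state is `step i` of the present one with probability `p i`. -/
theorem condExp_chain_succ [NeZero n] [IsProbabilityMeasure μ] (hι : ∀ k, Measurable (ι k))
    (hp : ∀ i, 0 < p i) (hlaw : ∀ k i, μ {ω | ι k ω = i} = ENNReal.ofReal (p i))
    (hindep : iIndepFun ι μ) (z0 : α) (W : α → ℝ) (k : ℕ) :
    μ[fun ω => W (chain step z0 (fun l => ι l ω) (k + 1)) | drawnFiltration ι hι k] =ᵐ[μ]
      fun ω => ∑ i, p i * W (step i (chain step z0 (fun l => ι l ω) k)) := by
  classical
  set Z : Ω → α := fun ω => chain step z0 (fun l => ι l ω) k with hZ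
  have hmeas : ∀ i, MeasurableSet {ω | ι k ω = i} := fun i => hι k (measurableSet_singleton i)
  let ind : Fin n → Ω → ℝ := fun i => ({ω | ι k ω = i}).indicator fun _ => 1
  let Y : Fin n → Ω → ℝ := fun i ω => W (step i (Z ω))
  have hsum : (fun ω => W (chain step z0 (fun l => ι l ω) (k + 1))) = ∑ i, Y i * ind i := by
    funext ω
    simp [Y, ind, chain, hZ, Set.indicator_apply]
  have hY : ∀ i, StronglyMeasurable[drawnFiltration ι hι k] (Y i) := fun i =>
    stronglyMeasurable_chain hι z0 (fun z => W (step i z)) k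
  have hindint : ∀ i, Integrable (ind i) μ := fun i =>
    (integrable_const (1 : ℝ)).indicator (hmeas i)
  have hYind : ∀ i, Integrable (Y i * ind i) μ := by
    intro i
    have : Y i * ind i = ({ω | ι k ω = i}).indicator (Y i) := by
      funext ω
      simp [ind, Set.indicator_apply]
    rw [this]
    exact (integrable_chain hι z0 (fun z => W (step i z)) k).indicator (hmeas i)
  have hcond : ∀ i, μ[ind i | drawnFiltration ι hι k] =ᵐ[μ] fun _ => p i := by
    intro i
    have hind : Indep (MeasurableSpace.comap (ι k) inferInstance)
        (drawnFiltration ι hι k) μ := by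
      have h := hindep.indepFun_finset {k} (Finset.range k) (by simp) hι
      have h2 := h.comp (φ := fun v : (({k} : Finset ℕ) → Fin n) => v ⟨k, by simp⟩) (ψ := id)
        Measurable.of_discrete measurable_id
      exact h2
    have hsm : StronglyMeasurable[MeasurableSpace.comap (ι k) inferInstance] (ind i) := by
      have : ind i = (fun l => if l = i then (1 : ℝ) else 0) ∘ ι k := by
        funext ω
        simp [ind, Set.indicator_apply]
      rw [this]
      exact (Measurable.of_discrete.comp (comap_measurable _)).stronglyMeasurable
    refine (condExp_indep_eq (hι k).comap_le ((drawnFiltration ι hι).le k) hsm hind).trans ?_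
    refine Eventually.of_forall fun _ => ?_
    simp only [ind]
    rw [integral_indicator_const _ (hmeas i), measureReal_def, hlaw,
      ENNReal.toReal_ofReal (hp i).le, smul_eq_mul, mul_one]
  rw [hsum]
  refine (condExp_finsetSum (fun i _ => hYind i) _).trans ?_
  have hall : ∀ᵐ ω ∂μ, ∀ i, (μ[Y i * ind i | drawnFiltration ι hι k]) ω = Y i ω * p i := by
    rw [ae_all_iff]
    intro i
    filter_upwards [condExp_mul_of_stronglyMeasurable_left (hY i) (hYind i) (hindint i),
      hcond i] with ω h1 h2
    rw [h1, Pi.mul_apply, h2]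
  filter_upwards [hall] with ω hω
  rw [Finset.sum_apply]
  exact Finset.sum_congr rfl fun i _ => by rw [hω i, mul_comm]

/-- A nonnegative function that does not increase in expectation converges along the sequence. -/
theorem ae_exists_tendsto_of_sum_le [NeZero n] [IsProbabilityMeasure μ]
    (hι : ∀ k, Measurable (ι k))
    (hp : ∀ i, 0 < p i) (hlaw : ∀ k i, μ {ω | ι k ω = i} = ENNReal.ofReal (p i))
    (hindep : iIndepFun ι μ) {D : Set α} (hD : ∀ i, ∀ z ∈ D, step i z ∈ D) {W : α → ℝ}
    (hW : ∀ z ∈ D, 0 ≤ W z) (hstep : ∀ z ∈ D, ∑ i, p i * W (step i z) ≤ W z)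
    {z0 : α} (hz0 : z0 ∈ D) :
    ∀ᵐ ω ∂μ, ∃ c, Tendsto (fun k => W (chain step z0 (fun l => ι l ω) k)) atTop (𝓝 c) := by
  set X : ℕ → Ω → ℝ := fun k ω => W (chain step z0 (fun l => ι l ω) k) with hX
  have hX0 : ∀ k ω, 0 ≤ X k ω := fun k ω => hW _ (chain_mem hD hz0 _ k)
  have hint : ∀ k, Integrable (X k) μ := fun k => integrable_chain hι z0 W k
  have hsuper : Supermartingale X (drawnFiltration ι hι) μ := by
    refine supermartingale_nat (fun k => stronglyMeasurable_chain hι z0 W k) hint fun k => ?_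
    filter_upwards [condExp_chain_succ (step := step) hι hp hlaw hindep z0 W k] with ω hω
    rw [hX, hω]
    exact hstep _ (chain_mem hD hz0 _ k)
  have hbdd : ∀ k, eLpNorm ((-X) k) 1 μ ≤ (W z0).toNNReal := by
    intro k
    have h1 := hsuper.setIntegral_le (Nat.zero_le k) MeasurableSet.univ
    have h0 : ∫ ω, X 0 ω ∂μ = W z0 := by simp [hX, chain]
    rw [setIntegral_univ, setIntegral_univ, h0] at h1
    rw [Pi.neg_apply, eLpNorm_neg, eLpNorm_one_eq_lintegral_enorm,
      ← ofReal_integral_norm_eq_lintegral_enorm (hint k)]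
    refine ENNReal.ofReal_le_ofReal (le_trans (le_of_eq ?_) h1)
    exact integral_congr_ae (Eventually.of_forall fun ω => by
      simp [abs_of_nonneg (hX0 k ω)])
  filter_upwards [hsuper.neg.exists_ae_tendsto_of_bdd hbdd] with ω ⟨c, hc⟩
  exact ⟨-c, by simpa using hc.neg⟩

/-- Robbins–Siegmund: if `V ≥ 0` decreases in expectation by at least `S ≥ 0`, then `V` converges
and `S` is summable along the sequence. The accumulated sum of `S` is carried along as a second
component of the state, and `ae_exists_tendsto_of_sum_le` is applied to its sum with `V`. -/
theorem ae_tendsto_and_summable [NeZero n] [IsProbabilityMeasure μ]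
    (hι : ∀ k, Measurable (ι k))
    (hp : ∀ i, 0 < p i) (hpsum : ∑ i, p i = 1)
    (hlaw : ∀ k i, μ {ω | ι k ω = i} = ENNReal.ofReal (p i))
    (hindep : iIndepFun ι μ) {D : Set α} (hD : ∀ i, ∀ z ∈ D, step i z ∈ D) {V S : α → ℝ}
    (hV : ∀ z ∈ D, 0 ≤ V z) (hS : ∀ z ∈ D, 0 ≤ S z)
    (hstep : ∀ z ∈ D, ∑ i, p i * V (step i z) ≤ V z - S z) {z0 : α} (hz0 : z0 ∈ D) :
    ∀ᵐ ω ∂μ, (∃ c, Tendsto (fun k => V (chain step z0 (fun l => ι l ω) k)) atTop (𝓝 c)) ∧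
      Summable fun k => S (chain step z0 (fun l => ι l ω) k) := by
  let step' : Fin n → α × ℝ → α × ℝ := fun i q => (step i q.1, q.2 + S q.1)
  have hchain : ∀ idx k, chain step' (z0, 0) idx k =
      (chain step z0 idx k, ∑ l ∈ Finset.range k, S (chain step z0 idx l)) := by
    intro idx k
    induction k with
    | zero => simp [chain]
    | succ k ih => rw [chain, ih, Finset.sum_range_succ]; rfl
  have h := ae_exists_tendsto_of_sum_le (step := step') hι hp hlaw hindep
    (D := {q | q.1 ∈ D ∧ 0 ≤ q.2}) (W := fun q => V q.1 + q.2)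
    (fun i q hq => ⟨hD i _ hq.1, add_nonneg hq.2 (hS _ hq.1)⟩)
    (fun q hq => add_nonneg (hV _ hq.1) hq.2) (fun q hq => by
      simp only [step', mul_add, Finset.sum_add_distrib, ← Finset.sum_mul, hpsum]
      linarith [hstep _ hq.1]) (z0 := (z0, 0)) ⟨hz0, le_rfl⟩
  filter_upwards [h] with ω ⟨c, hc⟩
  simp only [hchain] at hc
  have hmem := fun k => chain_mem hD hz0 (fun l => ι l ω) k
  obtain ⟨B, hB⟩ := hc.bddAbove_range
  have hsum : Summable fun k => S (chain step z0 (fun l => ι l ω) k) := by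
    refine summable_of_sum_range_le (c := B) (fun k => hS _ (hmem k)) fun k => ?_
    have := hB ⟨k, rfl⟩
    simp only at this
    linarith [hV _ (hmem k)]
  refine ⟨⟨_, (hc.sub hsum.hasSum.tendsto_sum_nat).congr fun k => ?_⟩, hsum⟩
  simp

/-- Almost surely, every index is drawn: the indicator that `i` has not been drawn decreases in
expectation by `p i` times itself. -/
theorem ae_forall_exists_drawn [NeZero n] [IsProbabilityMeasure μ]
    (hι : ∀ k, Measurable (ι k))
    (hp : ∀ i, 0 < p i) (hpsum : ∑ i, p i = 1)
    (hlaw : ∀ k i, μ {ω | ι k ω = i} = ENNReal.ofReal (p i)) (hindep : iIndepFun ι μ) :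
    ∀ᵐ ω ∂μ, ∀ i, ∃ k, ι k ω = i := by
  rw [ae_all_iff]
  intro i
  let step : Fin n → ℝ → ℝ := fun l s => if l = i then 0 else s
  have h := ae_tendsto_and_summable (step := step) hι hp hpsum hlaw hindep
    (D := Set.Ici 0) (V := id) (S := fun s => p i * s)
    (fun l s hs => by
      by_cases hl : l = i
      · simp [step, hl]
      · simpa [step, hl] using hs) (fun s hs => hs) (fun s hs => mul_nonneg (hp i).le hs)
    (fun s hs => by
      have : ∑ l, p l * id (step l s) = (∑ l, p l * s) - p i * s := by
        rw [eq_sub_iff_add_eq, ← Finset.add_sum_erase _ _ (Finset.mem_univ i),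
          ← Finset.add_sum_erase _ (fun l => p l * s) (Finset.mem_univ i)]
        have : ∀ l ∈ Finset.univ.erase i, p l * id (step l s) = p l * s := fun l hl => by
          simp [step, Finset.ne_of_mem_erase hl]
        rw [Finset.sum_congr rfl this]
        simp only [step, if_true, id, mul_zero]
        ring
      rw [this, ← Finset.sum_mul, hpsum, one_mul, id]) (z0 := 1) (by simp)
  filter_upwards [h] with ω ⟨_, hω⟩
  by_contra! hne
  have hconst : ∀ k, chain step 1 (fun l => ι l ω) k = 1 := by
    intro k
    induction k with
    | zero => rfl
    | succ k ih => simp [chain, step, hne k, ih]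
  simp only [hconst, mul_one] at hω
  exact (hp i).ne' ((summable_const_iff _).1 hω)

/-- To prove an almost sure tail property of the sequence, it suffices to start from states
reached after every index has been drawn: such a state is reached almost surely, it is determined
by the finite word of indices drawn so far, and there are countably many words. -/
theorem ae_chain_of_restart [NeZero n] [IsProbabilityMeasure μ]
    (hι : ∀ k, Measurable (ι k))
    (hp : ∀ i, 0 < p i) (hpsum : ∑ i, p i = 1)
    (hlaw : ∀ k i, μ {ω | ι k ω = i} = ENNReal.ofReal (p i)) (hindep : iIndepFun ι μ)
    (z0 : α) {D : Set α}
    (hDrawn : ∀ (idx : ℕ → Fin n) (N : ℕ), (∀ i, ∃ k < N, idx k = i) →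
      chain step z0 idx N ∈ D)
    {P : (ℕ → α) → Prop} (htail : ∀ (N : ℕ) (u : ℕ → α), P (fun k => u (N + k)) → P u)
    (hP : ∀ (κ : ℕ → Ω → Fin n), (∀ k, Measurable (κ k)) →
      (∀ k i, μ {ω | κ k ω = i} = ENNReal.ofReal (p i)) → iIndepFun κ μ → ∀ z ∈ D,
      ∀ᵐ ω ∂μ, P (chain step z fun l => κ l ω)) :
    ∀ᵐ ω ∂μ, P (chain step z0 fun l => ι l ω) := by
  let ext : ∀ N, (Fin N → Fin n) → ℕ → Fin n := fun N v l => if h : l < N then v ⟨l, h⟩ else 0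
  have h : ∀ᵐ ω ∂μ, ∀ (N : ℕ) (v : Fin N → Fin n), chain step z0 (ext N v) N ∈ D →
      P (chain step (chain step z0 (ext N v) N) fun l => ι (N + l) ω) := by
    rw [ae_all_iff]; intro N
    rw [ae_all_iff]; intro v
    by_cases hv : chain step z0 (ext N v) N ∈ D
    · filter_upwards [hP (fun l => ι (N + l)) (fun k => hι _) (fun k i => hlaw _ i)
        (hindep.precomp (add_right_injective N)) _ hv] with ω hω _
      exact hω
    · exact Eventually.of_forall fun ω h => absurd h hv
  filter_upwards [h, ae_forall_exists_drawn hι hp hpsum hlaw hindep] with ω h1 h2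
  choose k hk using h2
  obtain ⟨N, hN⟩ : ∃ N, ∀ i, k i < N :=
    ⟨Finset.univ.sup k + 1, fun i => Nat.lt_succ_of_le (Finset.le_sup (Finset.mem_univ i))⟩
  have hext : chain step z0 (ext N fun l => ι l ω) N = chain step z0 (fun l => ι l ω) N :=
    chain_congr _ fun l hl => by simp [ext, hl]
  have h3 := h1 N fun l => ι l ω
  rw [hext] at h3
  refine htail N _ ?_
  simp only [chain_add]
  exact h3 (hDrawn _ N fun i => ⟨k i, hN i, hk i⟩)

end Chain

end PureCD

/-! ### Block coordinates and separable functions -/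

namespace PureCD

section BlockCoordinates

variable {n m : ℕ} {d : Fin n → ℕ} {e : Fin m → ℕ}

theorem inner_single_left (i : Fin n) (u : EuclideanSpace ℝ (Fin (d i))) (v : Blocks d) :
    inner ℝ (PiLp.single 2 i u : Blocks d) v = inner ℝ u (v i) := by
  rw [PiLp.inner_apply, Finset.sum_eq_single i]
  · simp
  · intro l _ hl
    simp [hl]
  · simp

theorem inner_map_single (A : Blocks d →L[ℝ] Blocks e) (i : Fin n)
    (u : EuclideanSpace ℝ (Fin (d i))) (v : Blocks e) :
    inner ℝ (A (PiLp.single 2 i u)) v = inner ℝ u ((A.adjoint v) i) := by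
  rw [← ContinuousLinearMap.adjoint_inner_right, inner_single_left]

theorem sum_add_single_sub (F : ∀ l, EuclideanSpace ℝ (Fin (d l)) → ℝ) (x : Blocks d)
    (i : Fin n) (s : EuclideanSpace ℝ (Fin (d i))) :
    ∑ l, F l ((x + PiLp.single 2 i (s - x i) : Blocks d) l) = ∑ l, F l (x l) + (F i s - F i (x i)) := by
  rw [← Finset.add_sum_erase _ _ (Finset.mem_univ i),
    ← Finset.add_sum_erase _ (fun l => F l (x l)) (Finset.mem_univ i)]
  have : ∀ l ∈ Finset.univ.erase i,
      F l ((x + PiLp.single 2 i (s - x i) : Blocks d) l) = F l (x l) := fun l hl => by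
    simp [Finset.ne_of_mem_erase hl]
  rw [Finset.sum_congr rfl this]
  simp only [PiLp.add_apply, PiLp.single_eq_same, add_sub_cancel]
  ring

/-- A separable function in terms of real-valued functions `γ i` on sets `C i`. -/
structure IsSumOn (g : Blocks d → EReal) (C : ∀ i, Set (EuclideanSpace ℝ (Fin (d i))))
    (γ : ∀ i, EuclideanSpace ℝ (Fin (d i)) → ℝ) : Prop where
  ne_top_iff : ∀ x, g x ≠ ⊤ ↔ ∀ i, x i ∈ C i
  toReal_eq : ∀ x, g x ≠ ⊤ → (g x).toReal = ∑ i, γ i (x i)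

theorem ereal_sum_eq_coe {ι : Type*} (s : Finset ι) (a : ι → EReal) (hbot : ∀ i, a i ≠ ⊥)
    (htop : ∀ i ∈ s, a i ≠ ⊤) : ∑ i ∈ s, a i = ((∑ i ∈ s, (a i).toReal : ℝ) : EReal) := by
  classical
  induction s using Finset.induction_on with
  | empty => simp
  | insert i s hi ih =>
    rw [Finset.sum_insert hi, Finset.sum_insert hi, EReal.coe_add,
      ih fun l hl => htop l (Finset.mem_insert_of_mem hl),
      EReal.coe_toReal (htop i (Finset.mem_insert_self _ _)) (hbot i)]

theorem ereal_sum_ne_bot {ι : Type*} (s : Finset ι) (a : ι → EReal) (hbot : ∀ i, a i ≠ ⊥) :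
    ∑ i ∈ s, a i ≠ ⊥ := by
  classical
  induction s using Finset.induction_on with
  | empty => simp
  | insert i s hi ih =>
    rw [Finset.sum_insert hi, Ne, EReal.add_eq_bot_iff, not_or]
    exact ⟨hbot i, ih⟩

theorem exists_isSumOn {g : Blocks d → EReal} (hg : IsSeparable g) :
    ∃ C γ, IsSumOn g C γ := by
  obtain ⟨gi, hbot, hsum⟩ := hg
  have hiff : ∀ x, g x ≠ ⊤ ↔ ∀ i, gi i (x i) ≠ ⊤ := by
    intro x
    rw [hsum]
    constructor
    · intro h i hi
      refine h ?_
      rw [← Finset.add_sum_erase _ _ (Finset.mem_univ i), hi]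
      exact EReal.top_add_of_ne_bot (ereal_sum_ne_bot _ _ fun l => hbot l _)
    · intro h
      rw [ereal_sum_eq_coe _ _ (fun i => hbot i _) fun i _ => h i]
      exact EReal.coe_ne_top _
  refine ⟨fun i => {u | gi i u ≠ ⊤}, fun i u => (gi i u).toReal, hiff, fun x hx => ?_⟩
  rw [hsum, ereal_sum_eq_coe _ _ (fun i => hbot i _) fun i _ => (hiff x).1 hx i,
    EReal.toReal_coe]

/-- A subgradient of a separable function acts block by block. -/
theorem IsSumOn.block_subgradient {g : Blocks d → EReal}
    {C : ∀ i, Set (EuclideanSpace ℝ (Fin (d i)))}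
    {γ : ∀ i, EuclideanSpace ℝ (Fin (d i)) → ℝ} (hs : IsSumOn g C γ) (hg : ProperLscConvex g)
    {u v : Blocks d} (hv : v ∈ subdiff g u) {i : Fin n} {w : EuclideanSpace ℝ (Fin (d i))}
    (hw : w ∈ C i) : γ i (u i) + inner ℝ (v i) (w - u i) ≤ γ i w := by
  obtain ⟨hu, h⟩ := hg.mem_subdiff_iff.1 hv
  have hdom : g (u + PiLp.single 2 i (w - u i)) ≠ ⊤ := by
    rw [hs.ne_top_iff]
    intro l
    by_cases hl : l = i
    · subst hl; simpa using hw
    · simpa [hl] using (hs.ne_top_iff u).1 hu l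
  have := h _ hdom
  rw [hs.toReal_eq _ hu, hs.toReal_eq _ hdom, sum_add_single_sub, add_sub_cancel_left,
    real_inner_comm, inner_single_left, real_inner_comm] at this
  linarith

end BlockCoordinates

/-! ### The one-step inequality -/

section Step

variable {n m : ℕ} {d : Fin n → ℕ} {e : Fin m → ℕ}
  {f : Blocks d → ℝ} {g : Blocks d → EReal} {h : Blocks e → EReal}
  {A : Blocks d →L[ℝ] Blocks e} {β p τ : Fin n → ℝ} {σ θ : Fin m → ℝ}
  {C : ∀ i, Set (EuclideanSpace ℝ (Fin (d i)))} {γ : ∀ i, EuclideanSpace ℝ (Fin (d i)) → ℝ}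

/-- The standing assumptions on the problem, the sampling probabilities and the step sizes, with
the separable function `g` in the form of `IsSumOn`. -/
structure Setting (f : Blocks d → ℝ) (g : Blocks d → EReal) (h : Blocks e → EReal)
    (A : Blocks d →L[ℝ] Blocks e) (β p τ : Fin n → ℝ) (σ θ : Fin m → ℝ)
    (C : ∀ i, Set (EuclideanSpace ℝ (Fin (d i))))
    (γ : ∀ i, EuclideanSpace ℝ (Fin (d i)) → ℝ) : Prop where
  hf : ConvexOn ℝ Set.univ f
  hg : ProperLscConvex g
  hh : ProperLscConvex h
  hs : IsSumOn g C γ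
  hfβ : CoordSmooth f β
  hp : ∀ i, 0 < p i
  hpsum : ∑ i, p i = 1
  hτ : ∀ i, 0 < τ i
  hσ : ∀ j, 0 < σ j
  hθ : ∀ j, θ j = rowProb A p j / minProb p
  hθpos : ∀ j, 0 < θ j
  hstep : ∀ i, τ i * (β i * p i +
      (minProb p)⁻¹ * p i * ∑ j, rowProb A p j * σ j * ‖block A j i‖ ^ 2)
    < 2 * p i - minProb p

theorem minProb_le (p : Fin n → ℝ) (i : Fin n) : minProb p ≤ p i :=
  ciInf_le (Set.finite_range p).bddBelow i

theorem neZero_of_sum_eq_one (hpsum : ∑ i, p i = 1) : NeZero n := by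
  refine ⟨fun h => ?_⟩
  subst h
  simp at hpsum

theorem minProb_pos (hp : ∀ i, 0 < p i) (hpsum : ∑ i, p i = 1) : 0 < minProb p := by
  have := neZero_of_sum_eq_one hpsum
  obtain ⟨i, hi⟩ := exists_eq_ciInf_of_finite (f := p)
  rw [minProb, ← hi]
  exact hp i

theorem Setting.rowProb_pos (S : Setting f g h A β p τ σ θ C γ) (j : Fin m) :
    0 < rowProb A p j := by
  have h1 := S.hθpos j
  rw [S.hθ] at h1
  exact (div_pos_iff_of_pos_right (minProb_pos S.hp S.hpsum)).1 h1

theorem xNext_eq (i : Fin n) (z : Blocks d × Blocks e) :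
    xNext f g h A τ σ i z = z.1 + PiLp.single 2 i (xBar f g h A τ σ z i - z.1 i) := by
  ext l : 1
  by_cases hl : l = i
  · subst hl; simp [xNext]
  · simp [xNext, hl]

open Classical in
/-- Squared distance of the new dual block `j` to `ys j` when block `i` is drawn. -/
theorem norm_sq_yNext_sub (i : Fin n) (z : Blocks d × Blocks e) (ys : Blocks e) (j : Fin m) :
    ‖yNext f g h A τ σ θ i z j - ys j‖ ^ 2 = ‖z.2 j - ys j‖ ^ 2 +
      (if block A j i ≠ 0 then 1 else 0) *
        (‖yBar h A σ z j - ys j‖ ^ 2 - ‖z.2 j - ys j‖ ^ 2) +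
      2 * (σ j * θ j) * inner ℝ (yBar h A σ z j - ys j)
        (block A j i (xBar f g h A τ σ z i - z.1 i)) +
      (σ j * θ j) ^ 2 * ‖block A j i (xBar f g h A τ σ z i - z.1 i)‖ ^ 2 := by
  have hA : (A (xNext f g h A τ σ i z - z.1)) j =
      block A j i (xBar f g h A τ σ z i - z.1 i) := by
    rw [xNext_eq, add_sub_cancel_left]; rfl
  by_cases hb : block A j i = 0
  · simp [yNext, hb]
  · simp only [yNext, hA, ne_eq, hb, not_false_eq_true, if_true]
    have : yBar h A σ z j + (σ j * θ j) • block A j i (xBar f g h A τ σ z i - z.1 i) - ys j =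
        (yBar h A σ z j - ys j) +
          (σ j * θ j) • block A j i (xBar f g h A τ σ z i - z.1 i) := by abel
    rw [this, norm_add_sq_real, norm_smul, real_inner_smul_right, mul_pow, Real.norm_eq_abs,
      sq_abs]
    ring

/-- `f(x) + g(x) + ⟨A x, ys⟩` relative to its value at `xs`, for `zs = (xs, ys)`. -/
noncomputable def primalGap (f : Blocks d → ℝ) (g : Blocks d → EReal)
    (A : Blocks d →L[ℝ] Blocks e) (zs : Blocks d × Blocks e) (x : Blocks d) : ℝ :=
  (f x + (g x).toReal + inner ℝ (A x) zs.2) -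
    (f zs.1 + (g zs.1).toReal + inner ℝ (A zs.1) zs.2)

/-- The primal part `‖x - xs‖²` of the squared distance, in the metric `(τ p)⁻¹`. -/
noncomputable def primalDist (p τ : Fin n → ℝ) (xs x : Blocks d) : ℝ :=
  ∑ i, (τ i * p i)⁻¹ * ‖x i - xs i‖ ^ 2

/-- The dual part `‖y - ys‖²` of the squared distance, in the metric `(σ π)⁻¹`. -/
noncomputable def dualDist (A : Blocks d →L[ℝ] Blocks e) (p : Fin n → ℝ) (σ : Fin m → ℝ)
    (ys y : Blocks e) : ℝ :=
  ∑ j, (σ j * rowProb A p j)⁻¹ * ‖y j - ys j‖ ^ 2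

/-- The weighted squared distance of the Lyapunov function. -/
noncomputable def sqDist (A : Blocks d →L[ℝ] Blocks e) (p τ : Fin n → ℝ) (σ : Fin m → ℝ)
    (zs z : Blocks d × Blocks e) : ℝ :=
  primalDist p τ zs.1 z.1 + dualDist A p σ zs.2 z.2

/-- The Lyapunov function: weighted squared distance to `zs` plus primal gap. -/
noncomputable def lyapunov (f : Blocks d → ℝ) (g : Blocks d → EReal)
    (A : Blocks d →L[ℝ] Blocks e) (p τ : Fin n → ℝ) (σ : Fin m → ℝ)
    (zs z : Blocks d × Blocks e) : ℝ :=
  minProb p / 2 * sqDist A p τ σ zs z + primalGap f g A zs z.1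

/-- The coefficient of `‖x̄ i - x i‖²` in the decrease of the Lyapunov function; it is positive
exactly because of the step size condition. -/
noncomputable def decreaseCoeff (A : Blocks d →L[ℝ] Blocks e) (β p τ : Fin n → ℝ)
    (σ : Fin m → ℝ) (i : Fin n) : ℝ :=
  1 / 2 * ((2 * p i - minProb p) * (τ i)⁻¹ - p i * β i -
    (minProb p)⁻¹ * p i * ∑ j, rowProb A p j * σ j * ‖block A j i‖ ^ 2)

/-- The amount by which the Lyapunov function decreases in expectation. -/
noncomputable def decrease (f : Blocks d → ℝ) (g : Blocks d → EReal) (h : Blocks e → EReal)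
    (A : Blocks d →L[ℝ] Blocks e) (β p τ : Fin n → ℝ) (σ : Fin m → ℝ)
    (zs z : Blocks d × Blocks e) : ℝ :=
  minProb p * primalGap f g A zs z.1 +
    minProb p / 2 * ∑ j, (σ j)⁻¹ * ‖yBar h A σ z j - z.2 j‖ ^ 2 +
    ∑ i, decreaseCoeff A β p τ σ i * ‖xBar f g h A τ σ z i - z.1 i‖ ^ 2

theorem Setting.decreaseCoeff_pos (S : Setting f g h A β p τ σ θ C γ) (i : Fin n) :
    0 < decreaseCoeff A β p τ σ i := by
  have h1 := S.hstep i
  rw [← lt_div_iff₀' (S.hτ i), div_eq_mul_inv] at h1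
  rw [decreaseCoeff]
  linarith

/-- By the optimality condition at `zs`, the convex function `f + g + ⟨A ·, ys⟩` is minimal at
`xs`. -/
theorem Setting.primalGap_nonneg (S : Setting f g h A β p τ σ θ C γ) {zs : Blocks d × Blocks e}
    (hzs : zs ∈ kktSet f g h A) {x : Blocks d} (hx : g x ≠ ⊤) : 0 ≤ primalGap f g A zs x := by
  obtain ⟨⟨v, hv, hv0⟩, -⟩ := hzs
  have h1 := (S.hg.mem_subdiff_iff.1 hv).2 x hx
  have h2 := add_inner_gradient_le S.hf S.hfβ.1 zs.1 x
  have h3 : inner ℝ (gradient f zs.1 + v + A.adjoint zs.2) (x - zs.1) = 0 := by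
    rw [hv0, inner_zero_left]
  rw [inner_add_left, inner_add_left, ContinuousLinearMap.adjoint_inner_left, map_sub,
    inner_sub_right zs.2, real_inner_comm (A x), real_inner_comm (A zs.1)] at h3
  rw [primalGap]
  linarith

theorem Setting.xBar_subgradient (S : Setting f g h A β p τ σ θ C γ) (z : Blocks d × Blocks e) :
    (WithLp.toLp 2 fun i => (τ i)⁻¹ • (z.1 i - xBar f g h A τ σ z i) -
      (gradient f z.1 + A.adjoint (yBar h A σ z)) i : Blocks d) ∈
      subdiff g (xBar f g h A τ σ z) := by
  have h1 : _ ∈ subdiff g (xBar f g h A τ σ z) := (isProx_prox S.hτ S.hg (WithLp.toLp 2 fun i =>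
    z.1 i - τ i • (gradient f z.1 + A.adjoint (yBar h A σ z)) i)).mem_subdiff S.hg
  convert h1 using 2
  funext i
  simp only [xBar]
  rw [sub_right_comm (z.1 i), smul_sub (τ i)⁻¹ (_ - _), inv_smul_smul₀ (S.hτ i).ne']

theorem Setting.yBar_subgradient (S : Setting f g h A β p τ σ θ C γ) (z : Blocks d × Blocks e) :
    (WithLp.toLp 2 fun j => (σ j)⁻¹ • (z.2 j - yBar h A σ z j) + (A z.1) j : Blocks e) ∈
      subdiff (conj h) (yBar h A σ z) := by
  have h1 : _ ∈ subdiff (conj h) (yBar h A σ z) := (isProx_prox S.hσ S.hh.conj (WithLp.toLp 2 fun j =>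
    z.2 j + σ j • (A z.1) j)).mem_subdiff S.hh.conj
  convert h1 using 2
  funext j
  simp only [yBar]
  rw [add_sub_right_comm, smul_add, inv_smul_smul₀ (S.hσ j).ne']

theorem Setting.xBar_mem (S : Setting f g h A β p τ σ θ C γ) (z : Blocks d × Blocks e)
    (i : Fin n) : xBar f g h A τ σ z i ∈ C i :=
  (S.hs.ne_top_iff _).1 (S.hg.ne_top_of_mem_subdiff (S.xBar_subgradient z)) i

theorem Setting.xNext_ne_top (S : Setting f g h A β p τ σ θ C γ) (i : Fin n)
    {z : Blocks d × Blocks e} (hz : g z.1 ≠ ⊤) : g (xNext f g h A τ σ i z) ≠ ⊤ := by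
  rw [S.hs.ne_top_iff]
  intro l
  by_cases hl : l = i
  · subst hl
    simpa [xNext] using S.xBar_mem z l
  · simpa [xNext, hl] using (S.hs.ne_top_iff _).1 hz l

/-- Expected primal gap after one iteration: only block `i` of `x` moves, and coordinatewise
smoothness bounds the change of `f`. -/
theorem Setting.sum_primalGap_xNext_le (S : Setting f g h A β p τ σ θ C γ)
    (zs : Blocks d × Blocks e) {z : Blocks d × Blocks e} (hz : g z.1 ≠ ⊤) :
    ∑ i, p i * primalGap f g A zs (xNext f g h A τ σ i z) ≤ primalGap f g A zs z.1 +
      ∑ i, p i * (inner ℝ (gradient f z.1 i) (xBar f g h A τ σ z i - z.1 i) +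
        β i / 2 * ‖xBar f g h A τ σ z i - z.1 i‖ ^ 2 +
        (γ i (xBar f g h A τ σ z i) - γ i (z.1 i)) +
        inner ℝ (xBar f g h A τ σ z i - z.1 i) (A.adjoint zs.2 i)) := by
  have hsplit : primalGap f g A zs z.1 = ∑ i, p i * primalGap f g A zs z.1 := by
    rw [← Finset.sum_mul, S.hpsum, one_mul]
  rw [hsplit, ← Finset.sum_add_distrib]
  refine Finset.sum_le_sum fun i _ => ?_
  rw [← mul_add]
  refine mul_le_mul_of_nonneg_left ?_ (S.hp i).le
  have h1 := S.hs.toReal_eq _ (S.xNext_ne_top i hz)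
  rw [xNext_eq, sum_add_single_sub, ← S.hs.toReal_eq _ hz] at h1
  have h2 := S.hfβ.2 z.1 i (xBar f g h A τ σ z i - z.1 i)
  rw [primalGap, primalGap, xNext_eq, h1, map_add, inner_add_left, inner_map_single]
  linarith

theorem Setting.sum_primalDist_xNext (S : Setting f g h A β p τ σ θ C γ)
    (xs : Blocks d) (z : Blocks d × Blocks e) :
    ∑ i, p i * primalDist p τ xs (xNext f g h A τ σ i z) = primalDist p τ xs z.1 +
      ∑ i, (τ i)⁻¹ * (‖xBar f g h A τ σ z i - xs i‖ ^ 2 - ‖z.1 i - xs i‖ ^ 2) := by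
  have hsplit : primalDist p τ xs z.1 = ∑ i, p i * primalDist p τ xs z.1 := by
    rw [← Finset.sum_mul, S.hpsum, one_mul]
  rw [hsplit, ← Finset.sum_add_distrib]
  refine Finset.sum_congr rfl fun i _ => ?_
  rw [primalDist, xNext_eq,
    sum_add_single_sub (fun l u => (τ l * p l)⁻¹ * ‖u - xs l‖ ^ 2) z.1 i, primalDist, mul_add,
    mul_inv]
  have := (S.hp i).ne'
  field_simp

/-- Expected dual distance after one iteration. -/
theorem Setting.sum_dualDist_yNext_le (S : Setting f g h A β p τ σ θ C γ)
    (ys : Blocks e) (z : Blocks d × Blocks e) :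
    ∑ i, p i * dualDist A p σ ys (yNext f g h A τ σ θ i z) ≤ dualDist A p σ ys z.2 +
      ∑ j, (σ j)⁻¹ * (‖yBar h A σ z j - ys j‖ ^ 2 - ‖z.2 j - ys j‖ ^ 2) +
      2 * (minProb p)⁻¹ * ∑ i, p i * inner ℝ (xBar f g h A τ σ z i - z.1 i)
        (A.adjoint (yBar h A σ z - ys) i) +
      ((minProb p)⁻¹) ^ 2 * ∑ i, p i * ((∑ j, rowProb A p j * σ j * ‖block A j i‖ ^ 2) *
        ‖xBar f g h A τ σ z i - z.1 i‖ ^ 2) := by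
  classical
  have ha := minProb_pos S.hp S.hpsum
  set a := minProb p with ha_def
  set Δ : ∀ i, EuclideanSpace ℝ (Fin (d i)) := fun i => xBar f g h A τ σ z i - z.1 i
  have hinner : ∀ i, inner ℝ (Δ i) (A.adjoint (yBar h A σ z - ys) i) =
      ∑ j, inner ℝ (yBar h A σ z j - ys j) (block A j i (Δ i)) := by
    intro i
    rw [← inner_map_single, real_inner_comm, PiLp.inner_apply]
    rfl
  have hrow : ∀ j, rowProb A p j = ∑ i, p i * (if block A j i ≠ 0 then 1 else 0) := by
    intro j
    rw [rowProb, Finset.sum_filter]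
    simp
  -- Weighting block `j` by `(σ j π j)⁻¹` and using `θ j = π j / minProb p`, the factor of the
  -- cross term becomes `2 (minProb p)⁻¹` for every `j`.
  have hj : ∀ j, ∑ i, p i * ((σ j * rowProb A p j)⁻¹ *
        ‖yNext f g h A τ σ θ i z j - ys j‖ ^ 2) =
      (σ j * rowProb A p j)⁻¹ * ‖z.2 j - ys j‖ ^ 2 +
      (σ j)⁻¹ * (‖yBar h A σ z j - ys j‖ ^ 2 - ‖z.2 j - ys j‖ ^ 2) +
      ∑ i, (2 * a⁻¹ * (p i * inner ℝ (yBar h A σ z j - ys j) (block A j i (Δ i))) +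
        a⁻¹ ^ 2 * (p i * (rowProb A p j * σ j * ‖block A j i (Δ i)‖ ^ 2))) := by
    intro j
    have hπ := S.rowProb_pos j
    have hσ := S.hσ j
    have h1 : (σ j * rowProb A p j)⁻¹ * ‖z.2 j - ys j‖ ^ 2 =
        ∑ i, p i * ((σ j * rowProb A p j)⁻¹ * ‖z.2 j - ys j‖ ^ 2) := by
      rw [← Finset.sum_mul, S.hpsum, one_mul]
    have h2 : (σ j)⁻¹ * (‖yBar h A σ z j - ys j‖ ^ 2 - ‖z.2 j - ys j‖ ^ 2) =
        ∑ i, (p i * (if block A j i ≠ 0 then 1 else 0)) * ((σ j * rowProb A p j)⁻¹ *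
          (‖yBar h A σ z j - ys j‖ ^ 2 - ‖z.2 j - ys j‖ ^ 2)) := by
      rw [← Finset.sum_mul, ← hrow]
      field_simp
    rw [h1, h2, ← Finset.sum_add_distrib, ← Finset.sum_add_distrib]
    refine Finset.sum_congr rfl fun i _ => ?_
    rw [norm_sq_yNext_sub, S.hθ j, ← ha_def]
    field_simp
    ring
  have hbd : ∀ i j, rowProb A p j * σ j * ‖block A j i (Δ i)‖ ^ 2 ≤
      rowProb A p j * σ j * ‖block A j i‖ ^ 2 * ‖Δ i‖ ^ 2 := by
    intro i j
    rw [mul_assoc (rowProb A p j * σ j), ← mul_pow]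
    have := (S.rowProb_pos j).le
    have := (S.hσ j).le
    gcongr
    exact ContinuousLinearMap.le_opNorm _ _
  have hswap : ∑ i, p i * dualDist A p σ ys (yNext f g h A τ σ θ i z) =
      ∑ j, ∑ i, p i * ((σ j * rowProb A p j)⁻¹ *
        ‖yNext f g h A τ σ θ i z j - ys j‖ ^ 2) := by
    rw [Finset.sum_comm]
    simp only [dualDist, Finset.mul_sum]
  rw [hswap, Finset.sum_congr rfl fun j _ => hj j, Finset.sum_add_distrib,
    Finset.sum_add_distrib, Finset.sum_comm (s := Finset.univ (α := Fin m)),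
    add_assoc _ (2 * a⁻¹ * _)]
  refine add_le_add le_rfl ?_
  rw [Finset.mul_sum, Finset.mul_sum, ← Finset.sum_add_distrib]
  refine Finset.sum_le_sum fun i _ => ?_
  rw [Finset.sum_add_distrib, ← Finset.mul_sum, ← Finset.mul_sum, ← hinner, ← Finset.mul_sum,
    ← Finset.mul_sum, Finset.sum_mul]
  have hp := (S.hp i).le
  have hsum := Finset.sum_le_sum fun j (_ : j ∈ Finset.univ) => hbd i j
  gcongr

theorem inner_sub_sub_eq {E : Type*} [NormedAddCommGroup E] [InnerProductSpace ℝ E] (a b c : E) :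
    inner ℝ (a - b) (c - b) = 1 / 2 * (‖b - a‖ ^ 2 + (‖b - c‖ ^ 2 - ‖a - c‖ ^ 2)) := by
  have h1 := norm_sub_sq_real (a - b) (c - b)
  rw [sub_sub_sub_cancel_right] at h1
  rw [norm_sub_rev b a, norm_sub_rev b c]
  linarith

/-- Optimality of the dual proximal step, tested against a primal-dual solution. -/
theorem Setting.dual_inequality (S : Setting f g h A β p τ σ θ C γ)
    {zs : Blocks d × Blocks e} (hzs : zs ∈ kktSet f g h A) (z : Blocks d × Blocks e) :
    1 / 2 * ∑ j, (σ j)⁻¹ * ‖yBar h A σ z j - z.2 j‖ ^ 2 +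
      1 / 2 * ∑ j, (σ j)⁻¹ * (‖yBar h A σ z j - zs.2 j‖ ^ 2 - ‖z.2 j - zs.2 j‖ ^ 2) +
      inner ℝ (A (z.1 - zs.1)) (zs.2 - yBar h A σ z) ≤ 0 := by
  obtain ⟨-, w, hw, hw0⟩ := hzs
  rw [sub_eq_zero] at hw0
  obtain ⟨hb, h1⟩ := S.hh.conj.mem_subdiff_iff.1 (S.yBar_subgradient z)
  obtain ⟨hys, h2⟩ := S.hh.conj.mem_subdiff_iff.1 hw
  have h3 := h1 _ hys
  have h4 := h2 _ hb
  have h5 : inner ℝ (WithLp.toLp 2 fun j => (σ j)⁻¹ • (z.2 j - yBar h A σ z j) + (A z.1) j :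
      Blocks e) (zs.2 - yBar h A σ z) =
      1 / 2 * ∑ j, (σ j)⁻¹ * ‖yBar h A σ z j - z.2 j‖ ^ 2 +
      1 / 2 * ∑ j, (σ j)⁻¹ * (‖yBar h A σ z j - zs.2 j‖ ^ 2 - ‖z.2 j - zs.2 j‖ ^ 2) +
      inner ℝ (A z.1) (zs.2 - yBar h A σ z) := by
    rw [PiLp.inner_apply, PiLp.inner_apply, Finset.mul_sum, Finset.mul_sum,
      ← Finset.sum_add_distrib, ← Finset.sum_add_distrib]
    refine Finset.sum_congr rfl fun j _ => ?_
    rw [inner_add_left, real_inner_smul_left, PiLp.sub_apply, inner_sub_sub_eq]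
    ring
  rw [h5] at h3
  rw [← hw0, ← neg_sub zs.2, inner_neg_right] at h4
  rw [map_sub, inner_sub_left]
  linarith

/-- Optimality of the primal proximal step. Block `i` is tested against `xs i` with weight
`minProb p` and against `x i` with weight `p i - minProb p`. -/
theorem Setting.primal_inequality (S : Setting f g h A β p τ σ θ C γ)
    {zs : Blocks d × Blocks e} (hzs : g zs.1 ≠ ⊤) {z : Blocks d × Blocks e} (hz : g z.1 ≠ ⊤)
    (i : Fin n) :
    p i * (γ i (xBar f g h A τ σ z i) - γ i (z.1 i)) +
      p i * inner ℝ (gradient f z.1 i) (xBar f g h A τ σ z i - z.1 i) +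
      p i * inner ℝ (xBar f g h A τ σ z i - z.1 i) (A.adjoint (yBar h A σ z) i) +
      (p i - minProb p / 2) * (τ i)⁻¹ * ‖xBar f g h A τ σ z i - z.1 i‖ ^ 2 +
      minProb p / 2 * (τ i)⁻¹ * (‖xBar f g h A τ σ z i - zs.1 i‖ ^ 2 - ‖z.1 i - zs.1 i‖ ^ 2) ≤
    minProb p * (γ i (zs.1 i) - γ i (z.1 i)) +
      minProb p * inner ℝ (gradient f z.1 i) (zs.1 i - z.1 i) +
      minProb p * inner ℝ (A.adjoint (yBar h A σ z) i) (zs.1 i - z.1 i) := by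
  have ha := minProb_pos S.hp S.hpsum
  have h1 := S.hs.block_subgradient S.hg (S.xBar_subgradient z) ((S.hs.ne_top_iff _).1 hzs i)
  have h2 := S.hs.block_subgradient S.hg (S.xBar_subgradient z) ((S.hs.ne_top_iff _).1 hz i)
  simp only [PiLp.add_apply] at h1 h2
  rw [inner_sub_left, real_inner_smul_left, inner_add_left] at h1 h2
  set xb := xBar f g h A τ σ z i
  set yb := A.adjoint (yBar h A σ z) i
  set G := gradient f z.1 i
  have e1 : ∀ v, inner ℝ v (zs.1 i - xb) = inner ℝ v (zs.1 i - z.1 i) - inner ℝ v (xb - z.1 i) := by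
    intro v; rw [← inner_sub_right, sub_sub_sub_cancel_right]
  have e2 : ∀ v, inner ℝ v (z.1 i - xb) = -inner ℝ v (xb - z.1 i) := by
    intro v; rw [← inner_neg_right, neg_sub]
  rw [inner_sub_sub_eq, e1 G, e1 yb] at h1
  rw [real_inner_self_eq_norm_sq, e2 G, e2 yb, norm_sub_rev] at h2
  rw [real_inner_comm yb (xb - z.1 i)]
  have h3 := mul_le_mul_of_nonneg_left h1 ha.le
  have h4 := mul_le_mul_of_nonneg_left h2 (sub_nonneg.2 (minProb_le p i))
  linarith

/-- The Lyapunov function decreases in expectation. The choice `θ = π / minProb p` makes the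
cross term `⟨ȳ - ys, A P (x̄ - x)⟩` of the dual distance cancel against the primal terms. -/
theorem Setting.sum_lyapunov_le (S : Setting f g h A β p τ σ θ C γ)
    {zs : Blocks d × Blocks e} (hzs : zs ∈ kktSet f g h A) {z : Blocks d × Blocks e}
    (hz : g z.1 ≠ ⊤) :
    ∑ i, p i * lyapunov f g A p τ σ zs (xNext f g h A τ σ i z, yNext f g h A τ σ θ i z) ≤
      lyapunov f g A p τ σ zs z - decrease f g h A β p τ σ zs z := by
  have ha := minProb_pos S.hp S.hpsum
  have hxs : g zs.1 ≠ ⊤ := by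
    obtain ⟨⟨v, hv, -⟩, -⟩ := hzs
    exact S.hg.ne_top_of_mem_subdiff hv
  have e1 := S.sum_primalGap_xNext_le zs hz
  have e2 := S.sum_primalDist_xNext zs.1 z
  have e3 := S.sum_dualDist_yNext_le zs.2 z
  have e4 := S.dual_inequality hzs z
  have e5 := add_inner_gradient_le S.hf S.hfβ.1 z.1 zs.1
  have e6 := Finset.sum_le_sum fun i (_ : i ∈ Finset.univ) => S.primal_inequality hxs hz i
  have i0 : ∑ i, (minProb p * (γ i (zs.1 i) - γ i (z.1 i)) +
      minProb p * inner ℝ (gradient f z.1 i) (zs.1 i - z.1 i) +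
      minProb p * inner ℝ (A.adjoint (yBar h A σ z) i) (zs.1 i - z.1 i)) =
      minProb p * ∑ i, (γ i (zs.1 i) - γ i (z.1 i)) +
      minProb p * ∑ i, inner ℝ (gradient f z.1 i) (zs.1 i - z.1 i) +
      minProb p * ∑ i, inner ℝ (A.adjoint (yBar h A σ z) i) (zs.1 i - z.1 i) := by
    simp only [Finset.mul_sum, Finset.sum_add_distrib]
  have i1 : ∑ i, inner ℝ (gradient f z.1 i) (zs.1 i - z.1 i) =
      inner ℝ (gradient f z.1) (zs.1 - z.1) := by
    rw [PiLp.inner_apply]; rfl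
  have i2 : ∑ i, inner ℝ (A.adjoint (yBar h A σ z) i) (zs.1 i - z.1 i) =
      inner ℝ (yBar h A σ z) (A (zs.1 - z.1)) := by
    rw [← ContinuousLinearMap.adjoint_inner_left, PiLp.inner_apply]; rfl
  rw [i0, i1, i2, Finset.sum_sub_distrib, ← S.hs.toReal_eq _ hxs, ← S.hs.toReal_eq _ hz] at e6
  have hL : ∑ i, p i * lyapunov f g A p τ σ zs
      (xNext f g h A τ σ i z, yNext f g h A τ σ θ i z) =
      minProb p / 2 * (∑ i, p i * primalDist p τ zs.1 (xNext f g h A τ σ i z) +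
        ∑ i, p i * dualDist A p σ zs.2 (yNext f g h A τ σ θ i z)) +
      ∑ i, p i * primalGap f g A zs (xNext f g h A τ σ i z) := by
    simp only [lyapunov, sqDist, Finset.mul_sum, ← Finset.sum_add_distrib]
    exact Finset.sum_congr rfl fun i _ => by ring
  -- the sums over the primal blocks, collected
  have hcollect : ∑ i, p i * (inner ℝ (gradient f z.1 i) (xBar f g h A τ σ z i - z.1 i) +
        β i / 2 * ‖xBar f g h A τ σ z i - z.1 i‖ ^ 2 +
        (γ i (xBar f g h A τ σ z i) - γ i (z.1 i)) +
        inner ℝ (xBar f g h A τ σ z i - z.1 i) (A.adjoint zs.2 i)) +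
      minProb p / 2 * ∑ i, (τ i)⁻¹ *
        (‖xBar f g h A τ σ z i - zs.1 i‖ ^ 2 - ‖z.1 i - zs.1 i‖ ^ 2) +
      ∑ i, p i * inner ℝ (xBar f g h A τ σ z i - z.1 i)
        (A.adjoint (yBar h A σ z - zs.2) i) +
      (minProb p)⁻¹ / 2 * ∑ i, p i * ((∑ j, rowProb A p j * σ j * ‖block A j i‖ ^ 2) *
        ‖xBar f g h A τ σ z i - z.1 i‖ ^ 2) +
      ∑ i, decreaseCoeff A β p τ σ i * ‖xBar f g h A τ σ z i - z.1 i‖ ^ 2 =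
      ∑ i, (p i * (γ i (xBar f g h A τ σ z i) - γ i (z.1 i)) +
        p i * inner ℝ (gradient f z.1 i) (xBar f g h A τ σ z i - z.1 i) +
        p i * inner ℝ (xBar f g h A τ σ z i - z.1 i) (A.adjoint (yBar h A σ z) i) +
        (p i - minProb p / 2) * (τ i)⁻¹ * ‖xBar f g h A τ σ z i - z.1 i‖ ^ 2 +
        minProb p / 2 * (τ i)⁻¹ *
          (‖xBar f g h A τ σ z i - zs.1 i‖ ^ 2 - ‖z.1 i - zs.1 i‖ ^ 2)) := by
    rw [Finset.mul_sum, Finset.mul_sum]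
    simp only [← Finset.sum_add_distrib]
    refine Finset.sum_congr rfl fun i _ => ?_
    rw [map_sub, PiLp.sub_apply, inner_sub_right _ (A.adjoint _ i), decreaseCoeff]
    ring
  have e3' := mul_le_mul_of_nonneg_left e3 (half_pos ha).le
  have e4' := mul_le_mul_of_nonneg_left e4 ha.le
  have e5' := mul_le_mul_of_nonneg_left e5 ha.le
  have c1 : ∀ s : ℝ, minProb p / 2 * (2 * (minProb p)⁻¹ * s) = s := fun s => by field_simp
  have c2 : ∀ s : ℝ, minProb p / 2 * ((minProb p)⁻¹ ^ 2 * s) = (minProb p)⁻¹ / 2 * s :=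
    fun s => by field_simp
  rw [mul_add (minProb p / 2), mul_add (minProb p / 2), mul_add (minProb p / 2), c1, c2] at e3'
  rw [hL, e2, lyapunov, sqDist, decrease]
  -- the cross terms cancel
  have i3 : inner ℝ (yBar h A σ z) (A (zs.1 - z.1)) + inner ℝ (A z.1) zs.2 -
      inner ℝ (A zs.1) zs.2 + inner ℝ (A (z.1 - zs.1)) (yBar h A σ z - zs.2) = 0 := by
    simp only [map_sub, inner_sub_left, inner_sub_right, real_inner_comm (A z.1),
      real_inner_comm (A zs.1)]
    ring
  have i4 : inner ℝ (A (z.1 - zs.1)) (zs.2 - yBar h A σ z) =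
      -inner ℝ (A (z.1 - zs.1)) (yBar h A σ z - zs.2) := by
    rw [← inner_neg_right, neg_sub]
  rw [i4] at e4'
  have hgap : primalGap f g A zs z.1 = (f z.1 + (g z.1).toReal + inner ℝ (A z.1) zs.2) -
    (f zs.1 + (g zs.1).toReal + inner ℝ (A zs.1) zs.2) := rfl
  have hgap' := congrArg (minProb p * ·) hgap
  have i3' := congrArg (minProb p * ·) i3
  linarith

end Step

end PureCD

/-! ### Convergence -/

namespace PureCD

section Convergence

variable {n m : ℕ} {d : Fin n → ℕ} {e : Fin m → ℕ}
  {f : Blocks d → ℝ} {g : Blocks d → EReal} {h : Blocks e → EReal}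
  {A : Blocks d →L[ℝ] Blocks e} {β p τ : Fin n → ℝ} {σ θ : Fin m → ℝ}
  {C : ∀ i, Set (EuclideanSpace ℝ (Fin (d i)))} {γ : ∀ i, EuclideanSpace ℝ (Fin (d i)) → ℝ}

theorem exists_pos_mul_norm_sq_le {n : ℕ} {d : Fin n → ℕ} (s : Fin n → ℝ) (hs : ∀ i, 0 < s i) :
    ∃ c, 0 < c ∧ ∀ x : Blocks d, c * ‖x‖ ^ 2 ≤ ∑ i, s i * ‖x i‖ ^ 2 := by
  obtain ⟨c, hc, hcs⟩ := exists_pos_forall_le s hs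
  refine ⟨c, hc, fun x => ?_⟩
  rw [norm_sq_blocks, Finset.mul_sum]
  exact Finset.sum_le_sum fun i _ => mul_le_mul_of_nonneg_right (hcs i) (sq_nonneg _)

theorem norm_sub_sq_le {E : Type*} [SeminormedAddCommGroup E] (a b c : E) :
    ‖a - c‖ ^ 2 ≤ 2 * ‖a - b‖ ^ 2 + 2 * ‖b - c‖ ^ 2 := by
  have h := norm_sub_le_norm_sub_add_norm_sub a b c
  nlinarith [sq_nonneg (‖a - b‖ - ‖b - c‖), norm_nonneg (a - c)]

theorem continuous_sqDist (zs : Blocks d × Blocks e) : Continuous (sqDist A p τ σ zs) := by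
  unfold sqDist primalDist dualDist
  fun_prop

theorem sqDist_comm (zs z : Blocks d × Blocks e) : sqDist A p τ σ zs z = sqDist A p τ σ z zs := by
  simp only [sqDist, primalDist, dualDist, norm_sub_rev]

theorem sqDist_self (z : Blocks d × Blocks e) : sqDist A p τ σ z z = 0 := by
  simp [sqDist, primalDist, dualDist]

theorem Setting.primalWeight_pos (S : Setting f g h A β p τ σ θ C γ) (i : Fin n) :
    0 < (τ i * p i)⁻¹ :=
  inv_pos.2 (mul_pos (S.hτ i) (S.hp i))

theorem Setting.dualWeight_pos (S : Setting f g h A β p τ σ θ C γ) (j : Fin m) :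
    0 < (σ j * rowProb A p j)⁻¹ :=
  inv_pos.2 (mul_pos (S.hσ j) (S.rowProb_pos j))

theorem Setting.sqDist_nonneg (S : Setting f g h A β p τ σ θ C γ) (zs z : Blocks d × Blocks e) :
    0 ≤ sqDist A p τ σ zs z :=
  add_nonneg (Finset.sum_nonneg fun i _ => mul_nonneg (S.primalWeight_pos i).le (sq_nonneg _))
    (Finset.sum_nonneg fun j _ => mul_nonneg (S.dualWeight_pos j).le (sq_nonneg _))

theorem Setting.sqDist_triangle (S : Setting f g h A β p τ σ θ C γ)
    (zs t z : Blocks d × Blocks e) :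
    sqDist A p τ σ zs z ≤ 2 * sqDist A p τ σ t z + 2 * sqDist A p τ σ zs t := by
  have h1 : primalDist p τ zs.1 z.1 ≤
      2 * primalDist p τ t.1 z.1 + 2 * primalDist p τ zs.1 t.1 := by
    simp only [primalDist, Finset.mul_sum, ← Finset.sum_add_distrib]
    refine Finset.sum_le_sum fun i _ => ?_
    have := mul_le_mul_of_nonneg_left (norm_sub_sq_le (z.1 i) (t.1 i) (zs.1 i))
      (S.primalWeight_pos i).le
    linarith
  have h2 : dualDist A p σ zs.2 z.2 ≤
      2 * dualDist A p σ t.2 z.2 + 2 * dualDist A p σ zs.2 t.2 := by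
    simp only [dualDist, Finset.mul_sum, ← Finset.sum_add_distrib]
    refine Finset.sum_le_sum fun j _ => ?_
    have := mul_le_mul_of_nonneg_left (norm_sub_sq_le (z.2 j) (t.2 j) (zs.2 j))
      (S.dualWeight_pos j).le
    linarith
  simp only [sqDist]
  linarith

theorem Setting.exists_mul_dist_sq_le (S : Setting f g h A β p τ σ θ C γ) :
    ∃ c, 0 < c ∧ ∀ zs z : Blocks d × Blocks e, c * dist z zs ^ 2 ≤ sqDist A p τ σ zs z := by
  obtain ⟨c₁, hc₁, h₁⟩ := exists_pos_mul_norm_sq_le (d := d) _ S.primalWeight_pos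
  obtain ⟨c₂, hc₂, h₂⟩ := exists_pos_mul_norm_sq_le (d := e) _ S.dualWeight_pos
  refine ⟨min c₁ c₂, lt_min hc₁ hc₂, fun zs z => ?_⟩
  have h3 : c₁ * ‖z.1 - zs.1‖ ^ 2 ≤ primalDist p τ zs.1 z.1 := h₁ (z.1 - zs.1)
  have h4 : c₂ * ‖z.2 - zs.2‖ ^ 2 ≤ dualDist A p σ zs.2 z.2 := h₂ (z.2 - zs.2)
  have h5 : 0 ≤ c₁ * ‖z.1 - zs.1‖ ^ 2 := by positivity
  have h6 : 0 ≤ c₂ * ‖z.2 - zs.2‖ ^ 2 := by positivity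
  rw [sqDist, Prod.dist_eq, dist_eq_norm, dist_eq_norm]
  rcases max_choice ‖z.1 - zs.1‖ ‖z.2 - zs.2‖ with hm | hm <;> rw [hm]
  · have := mul_le_mul_of_nonneg_right (min_le_left c₁ c₂) (sq_nonneg ‖z.1 - zs.1‖)
    linarith
  · have := mul_le_mul_of_nonneg_right (min_le_right c₁ c₂) (sq_nonneg ‖z.2 - zs.2‖)
    linarith

/-- A limit of states that are asymptotically fixed by the proximal steps is a primal-dual
solution. -/
theorem Setting.mem_kktSet_of_tendsto (S : Setting f g h A β p τ σ θ C γ)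
    {u : ℕ → Blocks d × Blocks e} {a : Blocks d × Blocks e} (hu : Tendsto u atTop (𝓝 a))
    (hx : Tendsto (fun k => xBar f g h A τ σ (u k) - (u k).1) atTop (𝓝 0))
    (hy : Tendsto (fun k => yBar h A σ (u k) - (u k).2) atTop (𝓝 0)) :
    a ∈ kktSet f g h A := by
  have hu1 : Tendsto (fun k => (u k).1) atTop (𝓝 a.1) := (continuous_fst.tendsto a).comp hu
  have hu2 : Tendsto (fun k => (u k).2) atTop (𝓝 a.2) := (continuous_snd.tendsto a).comp hu
  have hxb : Tendsto (fun k => xBar f g h A τ σ (u k)) atTop (𝓝 a.1) := by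
    simpa using hx.add hu1
  have hyb : Tendsto (fun k => yBar h A σ (u k)) atTop (𝓝 a.2) := by
    simpa using hy.add hu2
  constructor
  · have hscale : Continuous fun w : Blocks d =>
        (WithLp.toLp 2 fun i => (τ i)⁻¹ • (-(w i)) : Blocks d) := by fun_prop
    have h1 : Tendsto (fun k => (WithLp.toLp 2 fun i =>
        (τ i)⁻¹ • (-((xBar f g h A τ σ (u k) - (u k).1) i)) : Blocks d) -
        (gradient f (u k).1 + A.adjoint (yBar h A σ (u k)))) atTop
        (𝓝 ((WithLp.toLp 2 fun i => (τ i)⁻¹ • (-((0 : Blocks d) i)) : Blocks d) -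
          (gradient f a.1 + A.adjoint a.2))) :=
      ((hscale.tendsto 0).comp hx).sub
        ((((continuous_gradient S.hf S.hfβ.1).tendsto a.1).comp hu1).add
          ((A.adjoint.continuous.tendsto a.2).comp hyb))
    have h2 := S.hg.mem_subdiff_of_tendsto hxb h1 fun k => by
      convert S.xBar_subgradient (u k) using 1
      ext i : 1
      simp
    refine ⟨_, h2, ?_⟩
    have h0 : (WithLp.toLp 2 fun i => (τ i)⁻¹ • (-((0 : Blocks d) i)) : Blocks d) = 0 := by
      ext i : 1
      simp
    rw [h0]
    abel
  · have hscale : Continuous fun w : Blocks e =>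
        (WithLp.toLp 2 fun j => (σ j)⁻¹ • (-(w j)) : Blocks e) := by fun_prop
    have h1 : Tendsto (fun k => (WithLp.toLp 2 fun j =>
        (σ j)⁻¹ • (-((yBar h A σ (u k) - (u k).2) j)) : Blocks e) + A (u k).1) atTop
        (𝓝 ((WithLp.toLp 2 fun j => (σ j)⁻¹ • (-((0 : Blocks e) j)) : Blocks e) + A a.1)) :=
      ((hscale.tendsto 0).comp hy).add ((A.continuous.tendsto a.1).comp hu1)
    have h2 := S.hh.conj.mem_subdiff_of_tendsto hyb h1 fun k => by
      convert S.yBar_subgradient (u k) using 1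
      ext j : 1
      simp
    refine ⟨_, h2, ?_⟩
    have h0 : (WithLp.toLp 2 fun j => (σ j)⁻¹ • (-((0 : Blocks e) j)) : Blocks e) = 0 := by
      ext j : 1
      simp
    rw [h0]
    abel

/-- Opial's argument: the sequence has a cluster point, which is a solution, and the distances to
the solutions of a dense subset converge. -/
theorem Setting.exists_tendsto (S : Setting f g h A β p τ σ θ C γ)
    (hsol : (kktSet f g h A).Nonempty) {T : Set (Blocks d × Blocks e)}
    (hT : kktSet f g h A ⊆ closure T) {u : ℕ → Blocks d × Blocks e}
    (hdist : ∀ t ∈ T, ∃ c, Tendsto (fun k => sqDist A p τ σ t (u k)) atTop (𝓝 c))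
    (hx : Tendsto (fun k => xBar f g h A τ σ (u k) - (u k).1) atTop (𝓝 0))
    (hy : Tendsto (fun k => yBar h A σ (u k) - (u k).2) atTop (𝓝 0)) :
    ∃ zstar ∈ kktSet f g h A, Tendsto u atTop (𝓝 zstar) := by
  obtain ⟨c, hc, hcd⟩ := S.exists_mul_dist_sq_le
  obtain ⟨t₀, ht₀⟩ : T.Nonempty := closure_nonempty_iff.1 (hsol.mono hT)
  have hbdd : Bornology.IsBounded (Set.range u) := by
    obtain ⟨b, hb⟩ := hdist t₀ ht₀
    obtain ⟨B, hB⟩ := hb.bddAbove_range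
    refine (Metric.isBounded_closedBall (x := t₀) (r := √(B / c))).subset ?_
    rintro _ ⟨k, rfl⟩
    refine Real.le_sqrt_of_sq_le ((le_div_iff₀' hc).2 ((hcd t₀ (u k)).trans (hB ⟨k, rfl⟩)))
  obtain ⟨a, -, φ, hφ, hφa⟩ := tendsto_subseq_of_bounded hbdd fun k => Set.mem_range_self k
  have ha : a ∈ kktSet f g h A :=
    S.mem_kktSet_of_tendsto hφa (hx.comp hφ.tendsto_atTop) (hy.comp hφ.tendsto_atTop)
  refine ⟨a, ha, ?_⟩
  have hsq : Tendsto (fun k => sqDist A p τ σ a (u k)) atTop (𝓝 0) := by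
    rw [Metric.tendsto_nhds]
    intro ε hε
    have hnear : ∀ᶠ t in 𝓝 a, sqDist A p τ σ a t < ε / 4 := by
      refine (continuous_sqDist a).continuousAt.eventually (gt_mem_nhds ?_)
      rw [sqDist_self]
      positivity
    obtain ⟨t, hta, htT⟩ := (mem_closure_iff_frequently.1 (hT ha)).and_eventually hnear |>.exists
    obtain ⟨b, hb⟩ := hdist t hta
    have hb' : b = sqDist A p τ σ t a :=
      tendsto_nhds_unique (hb.comp hφ.tendsto_atTop)
        (((continuous_sqDist t).tendsto a).comp hφa)
    have hbε : b < ε / 4 := by rwa [hb', sqDist_comm]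
    filter_upwards [hb.eventually (gt_mem_nhds hbε)] with k hk
    rw [Real.dist_eq, sub_zero, abs_of_nonneg (S.sqDist_nonneg _ _)]
    have := S.sqDist_triangle a t (u k)
    linarith
  rw [tendsto_iff_dist_tendsto_zero]
  have hd2 : Tendsto (fun k => dist (u k) a ^ 2) atTop (𝓝 0) := by
    refine squeeze_zero (fun k => sq_nonneg _) (fun k => (le_div_iff₀' hc).2 (hcd a (u k))) ?_
    simpa using hsq.div_const c
  simpa [Real.sqrt_sq dist_nonneg] using hd2.sqrt

theorem tendsto_zero_of_mul_norm_sq_le {E : Type*} [SeminormedAddCommGroup E] {w : ℕ → E}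
    {s : ℕ → ℝ} {c : ℝ} (hc : 0 < c) (hs : Tendsto s atTop (𝓝 0))
    (hws : ∀ k, c * ‖w k‖ ^ 2 ≤ s k) : Tendsto w atTop (𝓝 0) := by
  rw [tendsto_zero_iff_norm_tendsto_zero]
  have h2 : Tendsto (fun k => ‖w k‖ ^ 2) atTop (𝓝 0) := by
    refine squeeze_zero (fun k => sq_nonneg _) (fun k => (le_div_iff₀' hc).2 (hws k)) ?_
    simpa using hs.div_const c
  simpa [Real.sqrt_sq (norm_nonneg _)] using h2.sqrt

/-- One iteration when block `i` is drawn. -/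
noncomputable def nextState (f : Blocks d → ℝ) (g : Blocks d → EReal) (h : Blocks e → EReal)
    (A : Blocks d →L[ℝ] Blocks e) (τ : Fin n → ℝ) (σ θ : Fin m → ℝ) (i : Fin n)
    (z : Blocks d × Blocks e) : Blocks d × Blocks e :=
  (xNext f g h A τ σ i z, yNext f g h A τ σ θ i z)

theorem iterate_eq_chain (z0 : Blocks d × Blocks e) (idx : ℕ → Fin n) :
    iterate f g h A τ σ θ z0 idx = chain (nextState f g h A τ σ θ) z0 idx := by
  funext k
  induction k with
  | zero => rfl
  | succ k ih => simp only [iterate, chain, ih, nextState]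

/-- Each primal block enters the domain of its part of `g` when it is drawn, and stays there. -/
theorem Setting.chain_ne_top_of_drawn (S : Setting f g h A β p τ σ θ C γ)
    (z0 : Blocks d × Blocks e) (idx : ℕ → Fin n) (N : ℕ) (hN : ∀ i, ∃ k < N, idx k = i) :
    g (chain (nextState f g h A τ σ θ) z0 idx N).1 ≠ ⊤ := by
  have key : ∀ N i, (∃ k < N, idx k = i) →
      (chain (nextState f g h A τ σ θ) z0 idx N).1 i ∈ C i := by
    intro N
    induction N with
    | zero => rintro i ⟨k, hk, -⟩; exact absurd hk k.not_lt_zero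
    | succ N ih =>
      rintro i ⟨k, hk, hki⟩
      by_cases hi : i = idx N
      · subst hi
        simpa [chain, nextState, xNext] using S.xBar_mem _ _
      · have hkN : k ≠ N := fun h => hi (by rw [← hki, h])
        simpa [chain, nextState, xNext, hi] using ih i ⟨k, by omega, hki⟩
  exact (S.hs.ne_top_iff _).2 fun i => key N i (hN i)

/-- Almost sure convergence from a starting point in the domain of `g`, where the primal gap is
finite. The solutions `t` for which the Lyapunov function is used range over a countable dense
set, so that the exceptional null sets can be united. -/
theorem Setting.ae_tendsto_of_ne_top (S : Setting f g h A β p τ σ θ C γ)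
    (hsol : (kktSet f g h A).Nonempty)
    {Ω : Type*} [MeasurableSpace Ω] {μ : Measure Ω} [IsProbabilityMeasure μ]
    {ι : ℕ → Ω → Fin n} (hι : ∀ k, Measurable (ι k))
    (hlaw : ∀ k i, μ {ω | ι k ω = i} = ENNReal.ofReal (p i)) (hindep : iIndepFun ι μ)
    {z0 : Blocks d × Blocks e} (hz0 : g z0.1 ≠ ⊤) :
    ∀ᵐ ω ∂μ, ∃ zstar ∈ kktSet f g h A,
      Tendsto (chain (nextState f g h A τ σ θ) z0 fun l => ι l ω) atTop (𝓝 zstar) := by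
  have := neZero_of_sum_eq_one S.hpsum
  have ha := minProb_pos S.hp S.hpsum
  obtain ⟨T, hTsub, hTc, hTd⟩ :=
    (TopologicalSpace.IsSeparable.of_separableSpace (kktSet f g h A)).exists_countable_dense_subset
  have hD : ∀ i, ∀ z ∈ {z : Blocks d × Blocks e | g z.1 ≠ ⊤},
      nextState f g h A τ σ θ i z ∈ {z : Blocks d × Blocks e | g z.1 ≠ ⊤} :=
    fun i z hz => S.xNext_ne_top i hz
  obtain ⟨cx, hcx, hx⟩ := exists_pos_mul_norm_sq_le (d := d) _ S.decreaseCoeff_pos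
  obtain ⟨cy, hcy, hy⟩ := exists_pos_mul_norm_sq_le (d := e) (fun j => (σ j)⁻¹)
    fun j => inv_pos.2 (S.hσ j)
  have hterms : ∀ t ∈ T, ∀ z : Blocks d × Blocks e, g z.1 ≠ ⊤ →
      0 ≤ minProb p * primalGap f g A t z.1 ∧
      minProb p / 2 * cy * ‖yBar h A σ z - z.2‖ ^ 2 ≤
        minProb p / 2 * ∑ j, (σ j)⁻¹ * ‖yBar h A σ z j - z.2 j‖ ^ 2 ∧
      cx * ‖xBar f g h A τ σ z - z.1‖ ^ 2 ≤
        ∑ i, decreaseCoeff A β p τ σ i * ‖xBar f g h A τ σ z i - z.1 i‖ ^ 2 ∧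
      0 ≤ minProb p / 2 * cy * ‖yBar h A σ z - z.2‖ ^ 2 ∧
      0 ≤ cx * ‖xBar f g h A τ σ z - z.1‖ ^ 2 := by
    intro t ht z hz
    refine ⟨mul_nonneg ha.le (S.primalGap_nonneg (hTsub ht) hz), ?_, hx _, by positivity,
      by positivity⟩
    rw [mul_assoc]
    exact mul_le_mul_of_nonneg_left (hy _) (half_pos ha).le
  have hall : ∀ᵐ ω ∂μ, ∀ t ∈ T,
      (∃ c, Tendsto (fun k => lyapunov f g A p τ σ t
        (chain (nextState f g h A τ σ θ) z0 (fun l => ι l ω) k)) atTop (𝓝 c)) ∧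
      Summable fun k => decrease f g h A β p τ σ t
        (chain (nextState f g h A τ σ θ) z0 (fun l => ι l ω) k) := by
    rw [ae_ball_iff hTc]
    intro t ht
    refine ae_tendsto_and_summable hι S.hp S.hpsum hlaw hindep hD (fun z hz => ?_)
      (fun z hz => ?_) (fun z hz => S.sum_lyapunov_le (hTsub ht) hz) hz0
    · exact add_nonneg (mul_nonneg (half_pos ha).le (S.sqDist_nonneg t z))
        (S.primalGap_nonneg (hTsub ht) hz)
    · obtain ⟨h1, h2, h3, h4, h5⟩ := hterms t ht z hz
      rw [decrease]
      linarith
  filter_upwards [hall] with ω hω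
  set u := chain (nextState f g h A τ σ θ) z0 fun l => ι l ω with hu
  have hmem : ∀ k, g (u k).1 ≠ ⊤ := fun k => chain_mem hD hz0 _ k
  obtain ⟨t₀, ht₀⟩ : T.Nonempty := closure_nonempty_iff.1 (hsol.mono hTd)
  have hdec := (hω t₀ ht₀).2.tendsto_atTop_zero
  refine S.exists_tendsto hsol hTd (fun t ht => ?_)
    (tendsto_zero_of_mul_norm_sq_le hcx hdec fun k => ?_)
    (tendsto_zero_of_mul_norm_sq_le (mul_pos (half_pos ha) hcy) hdec fun k => ?_)
  · obtain ⟨⟨c, hc⟩, hsum⟩ := hω t ht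
    have hgap : Tendsto (fun k => primalGap f g A t (u k).1) atTop (𝓝 0) := by
      refine squeeze_zero (fun k => S.primalGap_nonneg (hTsub ht) (hmem k))
        (fun k => (le_div_iff₀' ha).2 ?_)
        (by simpa using hsum.tendsto_atTop_zero.div_const (minProb p))
      obtain ⟨h1, h2, h3, h4, h5⟩ := hterms t ht _ (hmem k)
      rw [decrease]
      linarith
    refine ⟨_, ((hc.sub hgap).div_const (minProb p / 2)).congr fun k => ?_⟩
    rw [lyapunov, add_sub_cancel_right, mul_div_cancel_left₀ _ (half_pos ha).ne']
  · obtain ⟨h1, h2, h3, h4, h5⟩ := hterms t₀ ht₀ _ (hmem k)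
    rw [decrease]
    linarith
  · obtain ⟨h1, h2, h3, h4, h5⟩ := hterms t₀ ht₀ _ (hmem k)
    rw [decrease]
    linarith

end Convergence

end PureCD

theorem theorem1
    {n m : ℕ} {d : Fin n → ℕ} {e : Fin m → ℕ}
    -- the problem `min_x f(x) + g(x) + h(A x)`
    (f : Blocks d → ℝ) (g : Blocks d → EReal) (h : Blocks e → EReal)
    (A : Blocks d →L[ℝ] Blocks e)
    (hf : ConvexOn ℝ Set.univ f)
    (hg : ProperLscConvex g) (hh : ProperLscConvex h)
    (hgsep : IsSeparable g)
    (β : Fin n → ℝ) (hfβ : CoordSmooth f β)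
    (hsol : (kktSet f g h A).Nonempty)
    (hslater : (0 : Blocks e) ∈ intrinsicInterior ℝ (effDom h - A '' effDom g))
    -- sampling probabilities, extrapolation parameters and step sizes
    (p : Fin n → ℝ) (hp : ∀ i, 0 < p i) (hpsum : ∑ i, p i = 1)
    (τ : Fin n → ℝ) (hτ : ∀ i, 0 < τ i)
    (σ : Fin m → ℝ) (hσ : ∀ j, 0 < σ j)
    (θ : Fin m → ℝ) (hθ : ∀ j, θ j = rowProb A p j / minProb p) (hθpos : ∀ j, 0 < θ j)
    -- `τ i < (2 p_i - p_min) / (β_i p_i + p_min⁻¹ p_i ∑_j π_j σ_j ‖A_{j,i}‖²)`,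
    -- where a denominator equal to `0` means no restriction
    (hstep : ∀ i, τ i * (β i * p i +
        (minProb p)⁻¹ * p i * ∑ j, rowProb A p j * σ j * ‖block A j i‖ ^ 2)
      < 2 * p i - minProb p)
    -- independent indices with law `p`
    {Ω : Type*} [MeasurableSpace Ω] (μ : Measure Ω) [IsProbabilityMeasure μ]
    (ι : ℕ → Ω → Fin n) (hιmeas : ∀ k, Measurable (ι k))
    (hιlaw : ∀ k i, μ {ω | ι k ω = i} = ENNReal.ofReal (p i))
    (hιindep : iIndepFun ι μ)
    (z0 : Blocks d × Blocks e) :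
    ∀ᵐ ω ∂μ, ∃ zstar ∈ kktSet f g h A,
      Tendsto (fun k => iterate f g h A τ σ θ z0 (fun l => ι l ω) k) atTop (𝓝 zstar) := by
  obtain ⟨C, γ, hs⟩ := exists_isSumOn hgsep
  have S : Setting f g h A β p τ σ θ C γ :=
    ⟨hf, hg, hh, hs, hfβ, hp, hpsum, hτ, hσ, hθ, hθpos, hstep⟩
  have := neZero_of_sum_eq_one hpsum
  simp only [iterate_eq_chain]
  refine ae_chain_of_restart hιmeas hp hpsum hιlaw hιindep z0
    (D := {z | g z.1 ≠ ⊤}) (S.chain_ne_top_of_drawn z0)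
    (P := fun u => ∃ zstar ∈ kktSet f g h A, Tendsto u atTop (𝓝 zstar)) ?_
    fun κ hκ hκlaw hκindep z hz => S.ae_tendsto_of_ne_top hsol hκ hκlaw hκindep hz
  rintro N u ⟨z, hz, hlim⟩
  refine ⟨z, hz, (tendsto_add_atTop_iff_nat N).1 ?_⟩
  simpa only [add_comm] using hlim
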